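/- Let $p>3$ be a prime and let $C=\langle\sigma\rangle$ be a cyclic group of order $p$. For $1\le i\le p$ let $M_i=\mathbb{F}_p[C]/(\sigma-1)^i$ be the unique (up to isomorphism) cyclic $\mathbb{F}_p[C]$-module of $\mathbb{F}_p$-dimension $i$. All cohomology is continuous cohomology; $\mathbb{F}_p$ carries the trivial action, and if $C$ acts on a pro-$p$ group $\Omega$ by continuous automorphisms, then $H^n(\Omega,\mathbb{F}_p)$ is an $\mathbb{F}_p[C]$-module by transport of structure. Then there is a torsion-free pro-$p$ group $\Omega$ (no element other than $1$ has finite order) with an action of $C$ by continuous automorphisms such that: 1. $H^1(\Omega,\mathbb{F}_p)\cong M_p$ as $\mathbb{F}_p[C]$-modules; 2. $H^2(\Omega,\mathbb{F}_p)$ is decomposable, i.e. it is generated by the cup products of elements of $H^1(\Omega,\mathbb{F}_p)$; 3. $H^2(\Omega,\mathbb{F}_p)\cong M_{p-1}\oplus M_p^{(p-3)/2}$ as $\mathbb{F}_p[C]$-modules; 4. $\Omega$ is a $C$-equivariant central extension $$1\to\mathbb{Z}_p\to\Omega\to\mathcal{G}\to 1,\qquad \mathcal{G}=\mathbb{Z}_p^{\,\mathbb{Z}/p},$$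 where $\sigma$ acts trivially on $\mathbb{Z}_p$ and by the cyclic shift $(\sigma u)_i=u_{i+1}$ on $\mathcal{G}$, and its class in $H^2(\mathcal{G},\mathbb{Z}_p)$ is $\sum_{i\in\mathbb{Z}/p} y_i\cup y_{i+1}$, where $y_i:\mathcal{G}\to\mathbb{Z}_p$ is the $i$-th coordinate; more precisely, the extension has a continuous section $s$ with $s(u)\,s(v)=\big(\sum_{i} u_i v_{i+1}\big)\cdot s(u+v)$ and $\sigma(s(u))=s(\sigma u)$ for all $u,v\in\mathcal{G}$. -/

import Mathlib

open CategoryTheory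

noncomputable section

namespace ProPOperator

/-- A profinite group is pro-`p` if its quotients by open normal subgroups are `p`-groups. -/
def IsProP (p : ℕ) (G : ProfiniteGrp.{0}) : Prop :=
  ∀ U : OpenNormalSubgroup G, IsPGroup p (G ⧸ U.toSubgroup)

section Cohomology

variable (p : ℕ) (G : Type) [Group G] [TopologicalSpace G] [IsTopologicalGroup G]

/-- The discrete field `𝔽_p` with trivial action of `G`. -/
abbrev coeff : TopRep (ZMod p) G :=
  TopRep.of (ContRepresentation.trivial (ZMod p) G (ZMod p))

/-- The continuous cohomology group `Hⁿ(G, 𝔽_p)`. -/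
abbrev H (n : ℕ) : TopModuleCat (ZMod p) :=
  continuousCohomology n (coeff p G)

variable {p G}

/-- The homogeneous continuous `1`-cochain underlying a `1`-cocycle. -/
def cochain₁ (a : ContinuousCohomology.cocycles (coeff p G) 1) : C(G, C(G, ZMod p)) :=
  (((TopRep.homogeneousCochains (coeff p G)).iCycles 1).hom a).1

/-- The homogeneous continuous `2`-cochain underlying a `2`-cocycle. -/
def cochain₂ (a : ContinuousCohomology.cocycles (coeff p G) 2) : C(G, C(G, C(G, ZMod p))) :=
  (((TopRep.homogeneousCochains (coeff p G)).iCycles 2).hom a).1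

/-- `ξ = α ∪ β`: on homogeneous cocycles the cup product is
`(a ∪ b)(x₀, x₁, x₂) = a(x₀, x₁) b(x₁, x₂)`. -/
def IsCupProduct (α β : H p G 1) (ξ : H p G 2) : Prop :=
  ∃ (a b : ContinuousCohomology.cocycles (coeff p G) 1)
    (c : ContinuousCohomology.cocycles (coeff p G) 2),
    (ContinuousCohomology.π (coeff p G) 1).hom a = α ∧
    (ContinuousCohomology.π (coeff p G) 1).hom b = β ∧
    (ContinuousCohomology.π (coeff p G) 2).hom c = ξ ∧
    ∀ x y z : G, cochain₂ c x y z = cochain₁ a x y * cochain₁ b y z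

variable (p G) in
/-- The decomposable part `H²(G, 𝔽_p)^dec`, generated by the cup products of classes in
`H¹(G, 𝔽_p)`. -/
def decomposable : Submodule (ZMod p) (H p G 2) :=
  Submodule.span (ZMod p) {ξ | ∃ α β : H p G 1, IsCupProduct α β ξ}

variable (p) in
/-- The identity of `𝔽_p`, viewed as a morphism from the restriction along `φ` of the trivial
module to the trivial module. -/
abbrev coeffHom {G' : Type} [Group G'] [TopologicalSpace G'] [IsTopologicalGroup G']
    (φ : G' →ₜ* G) : TopRep.res (φ : G' →* G) (coeff p G) ⟶ coeff p G' :=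
  TopRep.ofHom ⟨ContinuousLinearMap.id (ZMod p) (ZMod p), fun _ ↦ rfl⟩

variable (p) in
/-- The map induced on `Hⁿ(-, 𝔽_p)` by a continuous homomorphism. -/
def pullback {G' : Type} [Group G'] [TopologicalSpace G'] [IsTopologicalGroup G']
    (φ : G' →ₜ* G) (n : ℕ) : H p G n ⟶ H p G' n :=
  ContinuousCohomology.map φ (coeffHom p φ) n

lemma pullback_id (n : ℕ) : pullback p (ContinuousMonoidHom.id G) n = 𝟙 (H p G n) :=
  ContinuousCohomology.map_id (coeff p G) n

lemma pullback_comp {G' G'' : Type} [Group G'] [TopologicalSpace G'] [IsTopologicalGroup G']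
    [Group G''] [TopologicalSpace G''] [IsTopologicalGroup G'']
    (φ : G' →ₜ* G) (ψ : G'' →ₜ* G') (n : ℕ) :
    pullback p (φ.comp ψ) n = pullback p φ n ≫ pullback p ψ n := by
  unfold pullback
  rw [← ContinuousCohomology.map_comp φ ψ (coeffHom p φ) (coeffHom p ψ) n]
  rfl

end Cohomology

section Operator

variable {C : Type*} [Group C]
variable {G : Type} [Group G] [TopologicalSpace G] [IsTopologicalGroup G]
variable [MulDistribMulAction C G] [ContinuousConstSMul C G]

variable (G) in
/-- The continuous endomorphism `x ↦ c • x` of a topological group with operators. -/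
def actionHom (c : C) : G →ₜ* G where
  toMonoidHom := MulDistribMulAction.toMonoidHom G c
  continuous_toFun := continuous_const_smul c

/-- The action of the operator group `C` on `Hⁿ(G, 𝔽_p)`; on cochains,
`(c • f)(x₀, …, xₙ) = f(c⁻¹ • x₀, …, c⁻¹ • xₙ)`. -/
def cohomologyRep (p : ℕ) (C : Type*) [Group C] (G : Type) [Group G] [TopologicalSpace G]
    [IsTopologicalGroup G] [MulDistribMulAction C G] [ContinuousConstSMul C G] (n : ℕ) :
    Representation (ZMod p) C (H p G n) where
  toFun c := (pullback p (actionHom G c⁻¹) n).hom.toLinearMap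
  map_one' := by
    have h : actionHom G (1 : C)⁻¹ = ContinuousMonoidHom.id G := by
      ext x
      change (1 : C)⁻¹ • x = x
      simp
    rw [h, pullback_id]
    rfl
  map_mul' c d := by
    have h : actionHom G (c * d)⁻¹ = (actionHom G d⁻¹).comp (actionHom G c⁻¹) := by
      ext x
      change (c * d)⁻¹ • x = d⁻¹ • c⁻¹ • x
      simp [mul_smul]
    rw [h, pullback_comp]
    rfl

/-- For `C` cyclic of prime order `p` with generator `σ` and `i ≤ p`, this is the cyclic
`𝔽_p[C]`-module `M_i = 𝔽_p[C] / (σ - 1)ⁱ` of dimension `i`. -/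
abbrev cyclicModule (p : ℕ) (σ : C) (i : ℕ) : Type _ :=
  MonoidAlgebra (ZMod p) C ⧸
    Ideal.span {(MonoidAlgebra.of (ZMod p) C σ - 1) ^ i}

end Operator

/-- `G` is a `⟨σ⟩`-equivariant central extension of `𝒢 = ℤ_p^p` (coordinates indexed by `ℤ/p`, `σ`
acting by cyclic shift) by the trivial module `ℤ_p`, whose class in `H²(𝒢, ℤ_p)` is
`∑ i, yᵢ ∪ yᵢ₊₁`, where `yᵢ : 𝒢 → ℤ_p` is the `i`-th coordinate: there is a continuous `σ`-equivariant
section `s` whose factor set is the `2`-cocycle `(u, v) ↦ ∑ i, yᵢ(u) yᵢ₊₁(v)`. -/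
def IsCyclicCupExtension (p : ℕ) [Fact p.Prime] {C : Type*} [Group C] (σ : C)
    (G : Type) [Group G] [TopologicalSpace G] [MulDistribMulAction C G] : Prop :=
  ∃ (ι : Multiplicative ℤ_[p] →ₜ* G) (π : G →ₜ* Multiplicative (ZMod p → ℤ_[p]))
    (s : C(ZMod p → ℤ_[p], G)),
    Function.Injective ι ∧ Function.Surjective π ∧
    (ι : Multiplicative ℤ_[p] →* G).range = (π : G →* Multiplicative (ZMod p → ℤ_[p])).ker ∧
    (ι : Multiplicative ℤ_[p] →* G).range ≤ Subgroup.center G ∧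
    (∀ u, π (s u) = Multiplicative.ofAdd u) ∧
    (∀ u v, s u * s v =
      ι (Multiplicative.ofAdd (∑ i : ZMod p, u i * v (i + 1))) * s (u + v)) ∧
    (∀ a, σ • ι a = ι a) ∧
    (∀ x i, Multiplicative.toAdd (π (σ • x)) i = Multiplicative.toAdd (π x) (i + 1)) ∧
    (∀ u, σ • s u = s (fun i ↦ u (i + 1)))

end ProPOperator

end

/-!
The group `Ω` is the central extension of `ℤ_p ^ (ℤ/p)` by `ℤ_p` with the bilinear cocycle
`∑ i, uᵢ vᵢ₊₁`. The commutator of the lifts of two neighbouring generators generates the kernel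
`ℤ_p`, so `H¹(Ω)` is spanned by the coordinates `yᵢ`, permuted cyclically by `σ`.

Let `f` be a `2`-cocycle of `Ω`. Since `p > 3`, every generator commutes with two neighbouring
generators, hence `f (z, x) = f (x, z)` for central `z`; as `H²(ℤ_p) = 0`, `f` is then cohomologous
to the inflation of a cocycle of `ℤ_p ^ (ℤ/p)`. Thus `H²(Ω)` is the quotient of `H²(ℤ_p ^ (ℤ/p))`,
which consists of the `p × p` matrices modulo the symmetric ones, by the class `∑ i, yᵢ ∪ yᵢ₊₁` of
the extension. For each `d = 1, …, (p - 1) / 2` the matrices supported on the diagonal `j - i = d`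
form a free `𝔽_p[C]`-module of rank one, and the class that is killed is the norm element
`(σ - 1) ^ (p - 1)` on the diagonal `d = 1`.
-/

namespace ProPOperator

open scoped commutatorElement

noncomputable section

section TopModuleCat

variable {R : Type*} [Ring R] [TopologicalSpace R]

lemma topModuleCat_injective_of_mono {M N : TopModuleCat R} (f : M ⟶ N) [Mono f] :
    Function.Injective f.hom :=
  (ModuleCat.mono_iff_injective ((forget₂ _ (ModuleCat R)).map f)).1 inferInstance

lemma topModuleCat_surjective_of_epi {M N : TopModuleCat R} (f : M ⟶ N) [Epi f] :
    Function.Surjective f.hom :=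
  (ModuleCat.epi_iff_surjective ((forget₂ _ (ModuleCat R)).map f)).1 inferInstance

variable {I : Type*} {c : ComplexShape I} (K : HomologicalComplex (TopModuleCat R) c) {i j : I}

lemma iCycles_injective (i : I) : Function.Injective (K.iCycles i).hom :=
  topModuleCat_injective_of_mono _

lemma homologyπ_surjective (i : I) : Function.Surjective (K.homologyπ i).hom :=
  topModuleCat_surjective_of_epi _

/-- The cycle whose underlying chain is a given element of the kernel of the differential. -/
def cyclesMk (hij : c.next i = j) : (K.d i j).hom.ker →ₗ[R] K.cycles i :=
  (K.liftCycles (TopModuleCat.kerι (K.d i j)) j hij (TopModuleCat.kerι_comp _)).hom.toLinearMap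

lemma iCycles_cyclesMk (hij : c.next i = j) (x : (K.d i j).hom.ker) :
    (K.iCycles i).hom (cyclesMk K hij x) = x.1 :=
  ConcreteCategory.congr_hom
    (K.liftCycles_i (TopModuleCat.kerι (K.d i j)) j hij (TopModuleCat.kerι_comp _)) x

lemma d_iCycles (i j : I) (z : K.cycles i) : (K.d i j).hom ((K.iCycles i).hom z) = 0 :=
  ConcreteCategory.congr_hom (K.iCycles_d i j) z

lemma homologyπ_eq_zero_iff (hij : c.prev j = i) (z : K.cycles j) :
    (K.homologyπ j).hom z = 0 ↔ ∃ x, (K.d i j).hom x = (K.iCycles j).hom z := by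
  have iCycles_toCycles x : (K.iCycles j).hom ((K.toCycles i j).hom x) = (K.d i j).hom x :=
    ConcreteCategory.congr_hom (K.toCycles_i i j) x
  have isCokernel := K.homologyIsCokernel i j hij
  have π_desc : K.homologyπ j ≫ isCokernel.desc
      (Limits.CokernelCofork.ofπ _ (TopModuleCat.comp_cokerπ (K.toCycles i j))) =
        TopModuleCat.cokerπ (K.toCycles i j) :=
    isCokernel.fac _ Limits.WalkingParallelPair.one
  constructor
  · intro hz
    have hcoker : (TopModuleCat.cokerπ (K.toCycles i j)).hom z = 0 := by
      rw [← π_desc, TopModuleCat.hom_comp, ContinuousLinearMap.comp_apply, hz, map_zero]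
    obtain ⟨x, hx⟩ := (Submodule.Quotient.mk_eq_zero _).1 hcoker
    exact ⟨x, by rw [← iCycles_toCycles]; exact congrArg _ hx⟩
  · rintro ⟨x, hx⟩
    rw [← iCycles_toCycles] at hx
    rw [← iCycles_injective K j hx]
    exact ConcreteCategory.congr_hom (K.toCycles_comp_homologyπ i j) x

lemma homologyMap_homologyπ {L : HomologicalComplex (TopModuleCat R) c} (f : K ⟶ L)
    {z : K.cycles i} {w : L.cycles i}
    (h : (f.f i).hom ((K.iCycles i).hom z) = (L.iCycles i).hom w) :
    (HomologicalComplex.homologyMap f i).hom ((K.homologyπ i).hom z) =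
      (L.homologyπ i).hom w := by
  have hw : (HomologicalComplex.cyclesMap f i).hom z = w := iCycles_injective L i <|
    (ConcreteCategory.congr_hom (HomologicalComplex.cyclesMap_i f i) z).trans h
  rw [← hw]
  exact ConcreteCategory.congr_hom (HomologicalComplex.homologyπ_naturality f i) z

end TopModuleCat

section Cocycles

variable (R : Type*) [CommRing R] [TopologicalSpace R] [IsTopologicalRing R]
  (G : Type*) [Group G] [TopologicalSpace G]

/-- The inhomogeneous continuous `1`-cocycles of `G` with trivial coefficients `R`, i.e. the
continuous homomorphisms from `G` to the additive group of `R`. -/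
def contCocycles₁ : Submodule R C(G, R) where
  carrier := {h | ∀ x y, h (x * y) = h x + h y}
  zero_mem' := by simp
  add_mem' {h k} hh hk x y := by
    simp only [ContinuousMap.add_apply, hh x y, hk x y]
    ring
  smul_mem' c h hh x y := by simp only [ContinuousMap.smul_apply, hh x y, smul_add]

/-- The inhomogeneous continuous `2`-cocycles of `G` with trivial coefficients `R`. -/
def contCocycles₂ : Submodule R C(G × G, R) where
  carrier := {f | ∀ x y z, f (x, y) + f (x * y, z) = f (y, z) + f (x, y * z)}
  zero_mem' := by simp
  add_mem' {f g} hf hg x y z := by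
    simp only [ContinuousMap.add_apply]
    linear_combination hf x y z + hg x y z
  smul_mem' c f hf x y z := by
    simp only [ContinuousMap.smul_apply, smul_eq_mul]
    linear_combination c * hf x y z

variable {R G}

lemma contCocycles₁_mul (h : contCocycles₁ R G) (x y : G) : h.1 (x * y) = h.1 x + h.1 y :=
  h.2 x y

lemma contCocycles₂_identity (f : contCocycles₂ R G) (x y z : G) :
    f.1 (x, y) + f.1 (x * y, z) = f.1 (y, z) + f.1 (x, y * z) :=
  f.2 x y z

/-- The coboundary `(x, y) ↦ h x + h y - h (x * y)` of a continuous function `h`. -/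
def coboundary [ContinuousMul G] : C(G, R) →ₗ[R] contCocycles₂ R G where
  toFun h := ⟨⟨fun x ↦ h x.1 + h x.2 - h (x.1 * x.2), by fun_prop⟩, fun x y z ↦ by
    simp only [ContinuousMap.coe_mk, mul_assoc]
    ring⟩
  map_add' h k := by
    ext
    simp only [ContinuousMap.add_apply, ContinuousMap.coe_mk, Submodule.coe_add]
    ring
  map_smul' c h := by
    ext
    simp only [ContinuousMap.smul_apply, ContinuousMap.coe_mk, Submodule.coe_smul,
      RingHom.id_apply, smul_add, smul_sub]

@[simp]
lemma coboundary_apply [ContinuousMul G] (h : C(G, R)) (x y : G) :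
    (coboundary h).1 (x, y) = h x + h y - h (x * y) :=
  rfl

lemma mem_range_coboundary_iff [ContinuousMul G] {f : contCocycles₂ R G} :
    f ∈ LinearMap.range (coboundary (R := R) (G := G)) ↔
      ∃ h : C(G, R), ∀ x y, f.1 (x, y) = h x + h y - h (x * y) :=
  exists_congr fun _ ↦ ⟨fun h x y ↦ by rw [← h, coboundary_apply],
    fun h ↦ Subtype.ext <| ContinuousMap.ext fun x ↦ (h x.1 x.2).symm⟩

section Comap

variable {G' : Type*} [Group G'] [TopologicalSpace G']

/-- The restriction of `1`-cocycles along a continuous homomorphism. -/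
def comap₁ (φ : G' →ₜ* G) : contCocycles₁ R G →ₗ[R] contCocycles₁ R G' where
  toFun h := ⟨h.1.comp ⟨φ, map_continuous φ⟩, fun x y ↦ by
    simp only [ContinuousMap.comp_apply, ContinuousMap.coe_mk, map_mul, contCocycles₁_mul]⟩
  map_add' _ _ := rfl
  map_smul' _ _ := rfl

/-- The restriction of `2`-cocycles along a continuous homomorphism. -/
def comap₂ (φ : G' →ₜ* G) : contCocycles₂ R G →ₗ[R] contCocycles₂ R G' where
  toFun f := ⟨f.1.comp ⟨Prod.map φ φ, by fun_prop⟩, fun x y z ↦ by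
    simp only [ContinuousMap.comp_apply, ContinuousMap.coe_mk, Prod.map_apply, map_mul,
      contCocycles₂_identity]⟩
  map_add' _ _ := rfl
  map_smul' _ _ := rfl

@[simp]
lemma comap₁_apply (φ : G' →ₜ* G) (h : contCocycles₁ R G) (x : G') :
    (comap₁ φ h).1 x = h.1 (φ x) :=
  rfl

@[simp]
lemma comap₂_apply (φ : G' →ₜ* G) (f : contCocycles₂ R G) (x y : G') :
    (comap₂ φ f).1 (x, y) = f.1 (φ x, φ y) :=
  rfl

lemma comap₂_mem_range_coboundary [ContinuousMul G] [ContinuousMul G'] (φ : G' →ₜ* G)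
    {f : contCocycles₂ R G} (hf : f ∈ LinearMap.range coboundary) :
    comap₂ φ f ∈ LinearMap.range coboundary := by
  obtain ⟨h, hh⟩ := mem_range_coboundary_iff.1 hf
  refine mem_range_coboundary_iff.2 ⟨h.comp ⟨φ, map_continuous φ⟩, fun x y ↦ ?_⟩
  rw [comap₂_apply, hh, ← map_mul]
  rfl

end Comap

section Identities

variable (f : contCocycles₂ R G)

lemma cocycle_one_left (x : G) : f.1 (1, x) = f.1 (1, 1) := by
  simpa using (contCocycles₂_identity f 1 1 x).symm

lemma cocycle_one_right (x : G) : f.1 (x, 1) = f.1 (1, 1) := by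
  simpa using contCocycles₂_identity f x 1 1

lemma cocycle_sub_swap_mul {x y z : G} (hx : Commute x z) (hy : Commute y z) :
    f.1 (x * y, z) - f.1 (z, x * y) =
      (f.1 (x, z) - f.1 (z, x)) + (f.1 (y, z) - f.1 (z, y)) := by
  have h₁ := contCocycles₂_identity f x y z
  have h₂ := contCocycles₂_identity f z x y
  have h₃ := contCocycles₂_identity f x z y
  rw [hx.eq] at h₃
  rw [hy.eq] at h₁
  linear_combination h₁ + h₂ - h₃

lemma cocycle_commutatorElement_swap {x y z : G} (hx : Commute x z) (hy : Commute y z) :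
    f.1 (⁅x, y⁆, z) = f.1 (z, ⁅x, y⁆) := by
  let pairing : Subgroup.centralizer {z} →* Multiplicative R :=
    MonoidHom.mk' (fun x ↦ .ofAdd (f.1 (x.1, z) - f.1 (z, x.1))) fun x y ↦ congrArg _ <|
      cocycle_sub_swap_mul f (Subgroup.mem_centralizer_singleton_iff.1 x.2)
        (Subgroup.mem_centralizer_singleton_iff.1 y.2)
  let x' : Subgroup.centralizer {z} := ⟨x, Subgroup.mem_centralizer_singleton_iff.2 hx⟩
  let y' : Subgroup.centralizer {z} := ⟨y, Subgroup.mem_centralizer_singleton_iff.2 hy⟩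
  have pairing_commutator : pairing ⁅x', y'⁆ = 1 := by
    rw [map_commutatorElement, commutatorElement_eq_one_iff_mul_comm, mul_comm]
  exact sub_eq_zero.1 pairing_commutator

lemma cocycle_pow_pow (x : G) (a b : ℕ) :
    f.1 (x ^ a, x ^ b) = (f.1 (1, 1) - ∑ k ∈ Finset.range a, f.1 (x ^ k, x)) +
      (f.1 (1, 1) - ∑ k ∈ Finset.range b, f.1 (x ^ k, x)) -
      (f.1 (1, 1) - ∑ k ∈ Finset.range (a + b), f.1 (x ^ k, x)) := by
  induction b with
  | zero => simp [cocycle_one_right]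
  | succ b ih =>
    have h := contCocycles₂_identity f (x ^ a) (x ^ b) x
    rw [← pow_add, ← pow_succ] at h
    rw [← add_assoc, Finset.sum_range_succ _ (a + b), Finset.sum_range_succ _ b]
    linear_combination ih - h

end Identities

end Cocycles

section Comparison

variable {p : ℕ} {G : Type} [Group G] [TopologicalSpace G] [IsTopologicalGroup G]

variable (p G) in
/-- The complex of homogeneous continuous cochains computing `Hⁿ(G, 𝔽_p)`. -/
abbrev homogeneousComplex : CochainComplex (TopModuleCat (ZMod p)) ℕ :=
  TopRep.homogeneousCochains (coeff p G)

/-- The value of a homogeneous `0`-cochain. -/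
def evalCochain₀ (a : (homogeneousComplex p G).X 0) (x : G) : ZMod p :=
  (a.1 : C(G, ZMod p)) x

/-- The value of a homogeneous `1`-cochain, an iterated continuous function. -/
def evalCochain₁ (a : (homogeneousComplex p G).X 1) (x y : G) : ZMod p :=
  (a.1 : C(G, C(G, ZMod p))) x y

/-- The value of a homogeneous `2`-cochain, an iterated continuous function. -/
def evalCochain₂ (a : (homogeneousComplex p G).X 2) (x y z : G) : ZMod p :=
  (a.1 : C(G, C(G, C(G, ZMod p)))) x y z

/-- The value of a homogeneous `3`-cochain, an iterated continuous function. -/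
def evalCochain₃ (a : (homogeneousComplex p G).X 3) (w x y z : G) : ZMod p :=
  (a.1 : C(G, C(G, C(G, C(G, ZMod p))))) w x y z

@[ext]
lemma cochain₁_ext {a b : (homogeneousComplex p G).X 1}
    (h : ∀ x y, evalCochain₁ a x y = evalCochain₁ b x y) : a = b :=
  Subtype.ext (ContinuousMap.ext fun x ↦ ContinuousMap.ext fun y ↦ h x y)

@[ext]
lemma cochain₂_ext {a b : (homogeneousComplex p G).X 2}
    (h : ∀ x y z, evalCochain₂ a x y z = evalCochain₂ b x y z) : a = b :=
  Subtype.ext (ContinuousMap.ext fun x ↦ ContinuousMap.ext fun y ↦ ContinuousMap.ext fun z ↦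
    h x y z)

@[ext]
lemma cochain₃_ext {a b : (homogeneousComplex p G).X 3}
    (h : ∀ w x y z, evalCochain₃ a w x y z = evalCochain₃ b w x y z) : a = b :=
  Subtype.ext (ContinuousMap.ext fun w ↦ ContinuousMap.ext fun x ↦ ContinuousMap.ext fun y ↦
    ContinuousMap.ext fun z ↦ h w x y z)

lemma evalCochain₂_zero (x y z : G) :
    evalCochain₂ (0 : (homogeneousComplex p G).X 2) x y z = 0 :=
  rfl

lemma evalCochain₃_zero (w x y z : G) :
    evalCochain₃ (0 : (homogeneousComplex p G).X 3) w x y z = 0 :=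
  rfl

lemma evalCochain₁_d (a : (homogeneousComplex p G).X 0) (x y : G) :
    evalCochain₁ (((homogeneousComplex p G).d 0 1).hom a) x y =
      evalCochain₀ a y - evalCochain₀ a x := by
  unfold evalCochain₁
  rw [TopRep.homogeneousCochains.d_apply]
  rfl

lemma evalCochain₂_d (a : (homogeneousComplex p G).X 1) (x y z : G) :
    evalCochain₂ (((homogeneousComplex p G).d 1 2).hom a) x y z =
      evalCochain₁ a y z - (evalCochain₁ a x z - evalCochain₁ a x y) := by
  unfold evalCochain₂
  rw [TopRep.homogeneousCochains.d_apply]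
  rfl

lemma evalCochain₃_d (a : (homogeneousComplex p G).X 2) (w x y z : G) :
    evalCochain₃ (((homogeneousComplex p G).d 2 3).hom a) w x y z =
      evalCochain₂ a x y z -
        (evalCochain₂ a w y z - (evalCochain₂ a w x z - evalCochain₂ a w x y)) := by
  unfold evalCochain₃
  rw [TopRep.homogeneousCochains.d_apply]
  rfl

lemma evalCochain₀_eq_one (a : (homogeneousComplex p G).X 0) (x : G) :
    evalCochain₀ a x = evalCochain₀ a 1 := by
  rw [← inv_mul_cancel x]
  exact congrArg (fun f : C(G, ZMod p) ↦ f x) (a.2 x).symm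

lemma evalCochain₁_eq_one (a : (homogeneousComplex p G).X 1) (x y : G) :
    evalCochain₁ a x y = evalCochain₁ a 1 (x⁻¹ * y) := by
  rw [← inv_mul_cancel x]
  exact congrArg (fun f : C(G, C(G, ZMod p)) ↦ f x y) (a.2 x).symm

lemma evalCochain₂_eq_one (a : (homogeneousComplex p G).X 2) (x y z : G) :
    evalCochain₂ a x y z = evalCochain₂ a 1 (x⁻¹ * y) (x⁻¹ * z) := by
  rw [← inv_mul_cancel x]
  exact congrArg (fun f : C(G, C(G, C(G, ZMod p))) ↦ f x y z) (a.2 x).symm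

/-- The homogeneous `1`-cochain `(x, y) ↦ h (x⁻¹ * y)` attached to an inhomogeneous one. -/
def homogenize₁ : C(G, ZMod p) →ₗ[ZMod p] (homogeneousComplex p G).X 1 where
  toFun h := ⟨ContinuousMap.curry ⟨fun q : G × G ↦ h (q.1⁻¹ * q.2), by fun_prop⟩, by
    intro g
    refine ContinuousMap.ext fun x ↦ ContinuousMap.ext fun y ↦ ?_
    change h ((g⁻¹ * x)⁻¹ * (g⁻¹ * y)) = h (x⁻¹ * y)
    congr 1
    group⟩
  map_add' _ _ := rfl
  map_smul' _ _ := rfl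

/-- The homogeneous `2`-cochain `(x, y, z) ↦ f (x⁻¹ * y, y⁻¹ * z)` attached to an inhomogeneous
one. -/
def homogenize₂ : C(G × G, ZMod p) →ₗ[ZMod p] (homogeneousComplex p G).X 2 where
  toFun f := ⟨ContinuousMap.curry (ContinuousMap.curry
      ⟨fun q : (G × G) × G ↦ f (q.1.1⁻¹ * q.1.2, q.1.2⁻¹ * q.2), by fun_prop⟩), by
    intro g
    refine ContinuousMap.ext fun x ↦ ContinuousMap.ext fun y ↦ ContinuousMap.ext fun z ↦ ?_
    change f ((g⁻¹ * x)⁻¹ * (g⁻¹ * y), (g⁻¹ * y)⁻¹ * (g⁻¹ * z)) = f (x⁻¹ * y, y⁻¹ * z)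
    congr 2 <;> group⟩
  map_add' _ _ := rfl
  map_smul' _ _ := rfl

@[simp]
lemma evalCochain₁_homogenize₁ (h : C(G, ZMod p)) (x y : G) :
    evalCochain₁ (homogenize₁ h) x y = h (x⁻¹ * y) :=
  rfl

@[simp]
lemma evalCochain₂_homogenize₂ (f : C(G × G, ZMod p)) (x y z : G) :
    evalCochain₂ (homogenize₂ f) x y z = f (x⁻¹ * y, y⁻¹ * z) :=
  rfl

lemma d_homogenize₁ (h : C(G, ZMod p)) :
    ((homogeneousComplex p G).d 1 2).hom (homogenize₁ h) = homogenize₂ (coboundary h).1 := by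
  ext x y z
  rw [evalCochain₂_d, evalCochain₂_homogenize₂, coboundary_apply, mul_assoc, mul_inv_cancel_left]
  simp only [evalCochain₁_homogenize₁]
  ring

lemma d_homogenize₁_contCocycles₁ (h : contCocycles₁ (ZMod p) G) :
    ((homogeneousComplex p G).d 1 2).hom (homogenize₁ h.1) = 0 := by
  ext x y z
  rw [d_homogenize₁, evalCochain₂_homogenize₂, coboundary_apply,
    contCocycles₁_mul h (x⁻¹ * y), sub_self, evalCochain₂_zero]

lemma d_homogenize₂_contCocycles₂ (f : contCocycles₂ (ZMod p) G) :
    ((homogeneousComplex p G).d 2 3).hom (homogenize₂ f.1) = 0 := by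
  ext w x y z
  have h := contCocycles₂_identity f (w⁻¹ * x) (x⁻¹ * y) (y⁻¹ * z)
  simp only [mul_assoc, mul_inv_cancel_left] at h
  simp only [evalCochain₃_d, evalCochain₂_homogenize₂, evalCochain₃_zero]
  linear_combination -h

lemma exists_homogenize₁_eq {a : (homogeneousComplex p G).X 1}
    (ha : ((homogeneousComplex p G).d 1 2).hom a = 0) :
    ∃ h : contCocycles₁ (ZMod p) G, homogenize₁ h.1 = a := by
  refine ⟨⟨(a.1 : C(G, C(G, ZMod p))) 1, fun x y ↦ ?_⟩, ?_⟩
  · have h := evalCochain₂_d a 1 x (x * y)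
    rw [ha, evalCochain₂_zero, evalCochain₁_eq_one a x, inv_mul_cancel_left] at h
    change evalCochain₁ a 1 (x * y) = evalCochain₁ a 1 x + evalCochain₁ a 1 y
    linear_combination h
  · ext x y
    exact (evalCochain₁_eq_one a x y).symm

lemma exists_homogenize₂_eq [LocallyCompactSpace G] {a : (homogeneousComplex p G).X 2}
    (ha : ((homogeneousComplex p G).d 2 3).hom a = 0) :
    ∃ f : contCocycles₂ (ZMod p) G, homogenize₂ f.1 = a := by
  have hcont : Continuous fun q : G × G ↦ evalCochain₂ a 1 q.1 (q.1 * q.2) := by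
    -- uncurrying a continuous function `G → C(G, 𝔽_p)` relies on local compactness
    have h : ∀ F : C(G, C(G, C(G, ZMod p))), Continuous fun q : G × G ↦ F 1 q.1 (q.1 * q.2) :=
      fun F ↦ by fun_prop
    exact h a.1
  refine ⟨⟨⟨fun q ↦ evalCochain₂ a 1 q.1 (q.1 * q.2), hcont⟩, fun x y z ↦ ?_⟩, ?_⟩
  · have h := evalCochain₃_d a 1 x (x * y) (x * (y * z))
    rw [ha, evalCochain₃_zero, evalCochain₂_eq_one a x, inv_mul_cancel_left,
      inv_mul_cancel_left] at h
    change evalCochain₂ a 1 x (x * y) + evalCochain₂ a 1 (x * y) (x * y * z) =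
      evalCochain₂ a 1 y (y * z) + evalCochain₂ a 1 x (x * (y * z))
    rw [mul_assoc]
    linear_combination h
  · ext x y z
    change evalCochain₂ a 1 (x⁻¹ * y) (x⁻¹ * y * (y⁻¹ * z)) = _
    rw [evalCochain₂_eq_one a x, mul_assoc, mul_inv_cancel_left]

lemma homogenize₂_mem_range_d_iff {f : contCocycles₂ (ZMod p) G} :
    (∃ a, ((homogeneousComplex p G).d 1 2).hom a = homogenize₂ f.1) ↔
      f ∈ LinearMap.range coboundary := by
  constructor
  · rintro ⟨a, ha⟩
    refine mem_range_coboundary_iff.2 ⟨(a.1 : C(G, C(G, ZMod p))) 1, fun x y ↦ ?_⟩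
    have h := evalCochain₂_d a 1 x (x * y)
    rw [ha, evalCochain₂_homogenize₂, evalCochain₁_eq_one a x, inv_one, one_mul,
      inv_mul_cancel_left] at h
    change f.1 (x, y) = evalCochain₁ a 1 x + evalCochain₁ a 1 y - evalCochain₁ a 1 (x * y)
    linear_combination h
  · rintro ⟨h, rfl⟩
    exact ⟨homogenize₁ h, d_homogenize₁ h⟩

variable (p G) in
/-- The homogeneous cocycle attached to an inhomogeneous `1`-cocycle. -/
def homogeneousCocycle₁ :
    contCocycles₁ (ZMod p) G →ₗ[ZMod p] ContinuousCohomology.cocycles (coeff p G) 1 :=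
  cyclesMk (homogeneousComplex p G) (j := 2) (by simp) ∘ₗ
    (homogenize₁ ∘ₗ (contCocycles₁ (ZMod p) G).subtype).codRestrict _ d_homogenize₁_contCocycles₁

variable (p G) in
/-- The homogeneous cocycle attached to an inhomogeneous `2`-cocycle. -/
def homogeneousCocycle₂ :
    contCocycles₂ (ZMod p) G →ₗ[ZMod p] ContinuousCohomology.cocycles (coeff p G) 2 :=
  cyclesMk (homogeneousComplex p G) (j := 3) (by simp) ∘ₗ
    (homogenize₂ ∘ₗ (contCocycles₂ (ZMod p) G).subtype).codRestrict _ d_homogenize₂_contCocycles₂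

lemma iCycles_homogeneousCocycle₁ (h : contCocycles₁ (ZMod p) G) :
    ((homogeneousComplex p G).iCycles 1).hom (homogeneousCocycle₁ p G h) = homogenize₁ h.1 :=
  iCycles_cyclesMk _ _ _

lemma iCycles_homogeneousCocycle₂ (f : contCocycles₂ (ZMod p) G) :
    ((homogeneousComplex p G).iCycles 2).hom (homogeneousCocycle₂ p G f) = homogenize₂ f.1 :=
  iCycles_cyclesMk _ _ _

variable (p G) in
/-- The class map from inhomogeneous `1`-cocycles to `H¹(G, 𝔽_p)`. -/
def H1π : contCocycles₁ (ZMod p) G →ₗ[ZMod p] H p G 1 :=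
  (ContinuousCohomology.π (coeff p G) 1).hom.toLinearMap ∘ₗ homogeneousCocycle₁ p G

variable (p G) in
/-- The class map from inhomogeneous `2`-cocycles to `H²(G, 𝔽_p)`. -/
def H2π : contCocycles₂ (ZMod p) G →ₗ[ZMod p] H p G 2 :=
  (ContinuousCohomology.π (coeff p G) 2).hom.toLinearMap ∘ₗ homogeneousCocycle₂ p G

lemma H1π_injective : Function.Injective (H1π p G) := by
  refine (injective_iff_map_eq_zero _).2 fun h hh ↦ ?_
  obtain ⟨a, ha⟩ := (homologyπ_eq_zero_iff _ (i := 0) (by simp) _).1 hh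
  refine Subtype.ext (ContinuousMap.ext fun x ↦ ?_)
  have hx := evalCochain₁_d a 1 x
  rwa [ha, iCycles_homogeneousCocycle₁, evalCochain₀_eq_one, sub_self, evalCochain₁_homogenize₁,
    inv_one, one_mul] at hx

lemma H1π_surjective : Function.Surjective (H1π p G) := by
  intro ξ
  obtain ⟨z, rfl⟩ := homologyπ_surjective _ _ ξ
  obtain ⟨h, hh⟩ := exists_homogenize₁_eq (d_iCycles _ 1 2 z)
  exact ⟨h, congrArg (ContinuousCohomology.π (coeff p G) 1).hom <| iCycles_injective _ _ <|
    (iCycles_homogeneousCocycle₁ h).trans hh⟩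

lemma H2π_surjective [LocallyCompactSpace G] : Function.Surjective (H2π p G) := by
  intro ξ
  obtain ⟨z, rfl⟩ := homologyπ_surjective _ _ ξ
  obtain ⟨f, hf⟩ := exists_homogenize₂_eq (d_iCycles _ 2 3 z)
  exact ⟨f, congrArg (ContinuousCohomology.π (coeff p G) 2).hom <| iCycles_injective _ _ <|
    (iCycles_homogeneousCocycle₂ f).trans hf⟩

lemma H2π_eq_zero_iff {f : contCocycles₂ (ZMod p) G} :
    H2π p G f = 0 ↔ f ∈ LinearMap.range coboundary := by
  rw [← homogenize₂_mem_range_d_iff, ← iCycles_homogeneousCocycle₂]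
  exact homologyπ_eq_zero_iff _ (by simp) _

lemma isCupProduct_H2π {h k : contCocycles₁ (ZMod p) G} {f : contCocycles₂ (ZMod p) G}
    (hf : ∀ x y, f.1 (x, y) = h.1 x * k.1 y) :
    IsCupProduct (H1π p G h) (H1π p G k) (H2π p G f) := by
  refine ⟨homogeneousCocycle₁ p G h, homogeneousCocycle₁ p G k, homogeneousCocycle₂ p G f,
    rfl, rfl, rfl, fun x y z ↦ ?_⟩
  unfold cochain₁ cochain₂
  rw [iCycles_homogeneousCocycle₁, iCycles_homogeneousCocycle₁, iCycles_homogeneousCocycle₂]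
  exact hf (x⁻¹ * y) (y⁻¹ * z)

section Functoriality

variable {G' : Type} [Group G'] [TopologicalSpace G'] [IsTopologicalGroup G'] (φ : G' →ₜ* G)

lemma pullback_H1π (h : contCocycles₁ (ZMod p) G) :
    (pullback p φ 1).hom (H1π p G h) = H1π p G' (comap₁ φ h) := by
  refine homologyMap_homologyπ _ (ContinuousCohomology.cochainsMap φ (coeffHom p φ)) ?_
  rw [iCycles_homogeneousCocycle₁, iCycles_homogeneousCocycle₁]
  ext x y
  rw [evalCochain₁_homogenize₁, comap₁_apply, map_mul, map_inv]
  rfl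

lemma pullback_H2π (f : contCocycles₂ (ZMod p) G) :
    (pullback p φ 2).hom (H2π p G f) = H2π p G' (comap₂ φ f) := by
  refine homologyMap_homologyπ _ (ContinuousCohomology.cochainsMap φ (coeffHom p φ)) ?_
  rw [iCycles_homogeneousCocycle₂, iCycles_homogeneousCocycle₂]
  ext x y z
  rw [evalCochain₂_homogenize₂, comap₂_apply, map_mul, map_mul, map_inv, map_inv]
  rfl

variable {C : Type*} [Group C] [MulDistribMulAction C G] [ContinuousConstSMul C G] (c : C)

lemma cohomologyRep_H1π (h : contCocycles₁ (ZMod p) G) :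
    cohomologyRep p C G 1 c (H1π p G h) = H1π p G (comap₁ (actionHom G c⁻¹) h) :=
  pullback_H1π _ h

lemma cohomologyRep_H2π (f : contCocycles₂ (ZMod p) G) :
    cohomologyRep p C G 2 c (H2π p G f) = H2π p G (comap₂ (actionHom G c⁻¹) f) :=
  pullback_H2π _ f

end Functoriality

end Comparison

section Extension

attribute [local fun_prop] continuous_ofAdd continuous_toAdd

variable {R : Type*} [CommRing R] [TopologicalSpace R] [IsTopologicalRing R]
  {G : Type*} [Group G] [TopologicalSpace G]

/-- The central extension of `G` by the additive group of `R` with factor set `c`. -/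
@[ext]
structure CocycleExt (c : contCocycles₂ R G) where
  /-- The coordinate in `R`. -/
  val : R
  /-- The projection to `G`. -/
  base : G

namespace CocycleExt

variable {c : contCocycles₂ R G}

/-- The coordinates on `CocycleExt c`. -/
def equivProd (c : contCocycles₂ R G) : CocycleExt c ≃ R × G where
  toFun x := (x.val, x.base)
  invFun q := ⟨q.1, q.2⟩

instance : TopologicalSpace (CocycleExt c) := .induced (equivProd c) inferInstance

/-- `CocycleExt c` is homeomorphic to the product of kernel and quotient. -/
def homeoProd (c : contCocycles₂ R G) : CocycleExt c ≃ₜ R × G :=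
  (equivProd c).toHomeomorphOfIsInducing ⟨rfl⟩

instance [CompactSpace R] [CompactSpace G] : CompactSpace (CocycleExt c) :=
  (homeoProd c).symm.compactSpace

instance [T2Space R] [T2Space G] : T2Space (CocycleExt c) :=
  (homeoProd c).symm.t2Space

instance [TotallyDisconnectedSpace R] [TotallyDisconnectedSpace G] :
    TotallyDisconnectedSpace (CocycleExt c) :=
  (homeoProd c).symm.totallyDisconnectedSpace

@[fun_prop]
lemma continuous_val : Continuous (val : CocycleExt c → R) :=
  continuous_fst.comp (homeoProd c).continuous

@[fun_prop]
lemma continuous_base : Continuous (base : CocycleExt c → G) :=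
  continuous_snd.comp (homeoProd c).continuous

@[fun_prop]
lemma continuous_mk {X : Type*} [TopologicalSpace X] {f : X → R} {g : X → G}
    (hf : Continuous f) (hg : Continuous g) : Continuous fun x ↦ (⟨f x, g x⟩ : CocycleExt c) :=
  (homeoProd c).symm.continuous.comp (hf.prodMk hg)

instance : Mul (CocycleExt c) :=
  ⟨fun x y ↦ ⟨x.val + y.val + c.1 (x.base, y.base), x.base * y.base⟩⟩

instance : One (CocycleExt c) := ⟨⟨-c.1 (1, 1), 1⟩⟩

instance : Inv (CocycleExt c) :=
  ⟨fun x ↦ ⟨-x.val - c.1 (x.base⁻¹, x.base) - c.1 (1, 1), x.base⁻¹⟩⟩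

@[simp]
lemma mul_val (x y : CocycleExt c) : (x * y).val = x.val + y.val + c.1 (x.base, y.base) := rfl

@[simp]
lemma mul_base (x y : CocycleExt c) : (x * y).base = x.base * y.base := rfl

@[simp]
lemma one_val : (1 : CocycleExt c).val = -c.1 (1, 1) := rfl

@[simp]
lemma one_base : (1 : CocycleExt c).base = 1 := rfl

@[simp]
lemma inv_val (x : CocycleExt c) :
    x⁻¹.val = -x.val - c.1 (x.base⁻¹, x.base) - c.1 (1, 1) := rfl

@[simp]
lemma inv_base (x : CocycleExt c) : x⁻¹.base = x.base⁻¹ := rfl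

instance : Group (CocycleExt c) :=
  Group.ofLeftAxioms
    (fun x y z ↦ CocycleExt.ext (by
      simp only [mul_val, mul_base]
      linear_combination contCocycles₂_identity c x.base y.base z.base) (mul_assoc _ _ _))
    (fun x ↦ CocycleExt.ext (by
      simp only [mul_val, one_val, one_base, cocycle_one_left c x.base]
      ring) (one_mul _))
    (fun x ↦ CocycleExt.ext (by
      simp only [mul_val, inv_val, inv_base, one_val]
      ring) (inv_mul_cancel _))

instance [ContinuousMul G] : ContinuousMul (CocycleExt c) where
  continuous_mul := continuous_mk (by fun_prop) (by fun_prop)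

instance [IsTopologicalGroup G] : IsTopologicalGroup (CocycleExt c) where
  continuous_inv := continuous_mk (by fun_prop) (by fun_prop)

/-- The projection of the extension to `G`. -/
def baseHom (c : contCocycles₂ R G) : CocycleExt c →ₜ* G where
  toFun := base
  map_one' := rfl
  map_mul' _ _ := rfl
  continuous_toFun := continuous_base

@[simp]
lemma baseHom_apply (x : CocycleExt c) : baseHom c x = x.base := rfl

/-- The inclusion of the kernel. The shift accounts for factor sets that are not normalized. -/
def scalar (c : contCocycles₂ R G) : Multiplicative R →ₜ* CocycleExt c where
  toFun a := ⟨a.toAdd - c.1 (1, 1), 1⟩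
  map_one' := CocycleExt.ext (by simp) rfl
  map_mul' a b := CocycleExt.ext (by simp; ring) (by simp)
  continuous_toFun := continuous_mk (continuous_toAdd.sub continuous_const) continuous_const

@[simp]
lemma scalar_val (a : Multiplicative R) : (scalar c a).val = a.toAdd - c.1 (1, 1) := rfl

@[simp]
lemma scalar_base (a : Multiplicative R) : (scalar c a).base = 1 := rfl

lemma scalar_mul (a : Multiplicative R) (x : CocycleExt c) :
    scalar c a * x = ⟨a.toAdd + x.val, x.base⟩ :=
  CocycleExt.ext (by simp [cocycle_one_left c x.base]; ring) (by simp)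

lemma scalar_commute (a : Multiplicative R) (x : CocycleExt c) : Commute (scalar c a) x :=
  (scalar_mul a x).trans <|
    CocycleExt.ext (by simp [cocycle_one_right c x.base]; ring) (by simp)

lemma scalar_injective : Function.Injective (scalar c) := fun _ _ h ↦
  Multiplicative.toAdd.injective (sub_left_injective (congrArg val h))

lemma range_scalar : (scalar c : Multiplicative R →* CocycleExt c).range =
    (baseHom c : CocycleExt c →* G).ker := by
  ext x
  refine ⟨?_, fun hx ↦ ⟨.ofAdd (x.val + c.1 (1, 1)), CocycleExt.ext (by simp) ?_⟩⟩
  · rintro ⟨a, rfl⟩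
    rfl
  · exact (MonoidHom.mem_ker.1 hx).symm

/-- The standard section. -/
def sec (c : contCocycles₂ R G) : C(G, CocycleExt c) where
  toFun u := ⟨0, u⟩
  continuous_toFun := continuous_mk continuous_const continuous_id

@[simp]
lemma sec_val (u : G) : (sec c u).val = 0 := rfl

@[simp]
lemma sec_base (u : G) : (sec c u).base = u := rfl

lemma scalar_mul_sec (x : CocycleExt c) : scalar c (.ofAdd x.val) * sec c x.base = x := by
  rw [scalar_mul, sec_val, toAdd_ofAdd, add_zero, sec_base]

lemma sec_mul_sec (u v : G) : sec c u * sec c v = scalar c (.ofAdd (c.1 (u, v))) * sec c (u * v) :=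
  CocycleExt.ext (by simp [scalar_mul]) (by simp)

lemma sec_commute {u v : G} (h : Commute u v) (hc : c.1 (u, v) = c.1 (v, u)) :
    Commute (sec c u) (sec c v) := by
  rw [commute_iff_eq, sec_mul_sec, sec_mul_sec, hc, h.eq]

lemma commutatorElement_sec {u v : G} (h : Commute u v) :
    ⁅sec c u, sec c v⁆ = scalar c (.ofAdd (c.1 (u, v) - c.1 (v, u))) := by
  rw [commutatorElement_def, mul_inv_eq_iff_eq_mul, mul_inv_eq_iff_eq_mul, mul_assoc, sec_mul_sec,
    sec_mul_sec, h.eq, ← mul_assoc, ← map_mul, ← ofAdd_add, sub_add_cancel]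

lemma comap₂_baseHom_self [ContinuousMul G] :
    comap₂ (baseHom c) c ∈ LinearMap.range coboundary :=
  mem_range_coboundary_iff.2 ⟨⟨fun x ↦ -x.val, by fun_prop⟩, fun x y ↦ by
    simp only [comap₂_apply, baseHom_apply, ContinuousMap.coe_mk, mul_val]
    ring⟩

lemma exists_lift_of_comap₂_mem_range_coboundary {G' : Type*} [Group G'] [TopologicalSpace G']
    [ContinuousMul G'] {φ : G' →ₜ* G} (h : comap₂ φ c ∈ LinearMap.range coboundary) :
    ∃ T : G' →ₜ* CocycleExt c, ∀ x, (T x).base = φ x := by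
  obtain ⟨h, hh⟩ := mem_range_coboundary_iff.1 h
  have hmul (x y : G') : (⟨-h (x * y), φ (x * y)⟩ : CocycleExt c) =
      ⟨-h x, φ x⟩ * ⟨-h y, φ y⟩ := by
    refine CocycleExt.ext ?_ (map_mul φ x y)
    rw [mul_val, ← comap₂_apply φ c, hh]
    ring
  exact ⟨⟨MonoidHom.mk' (fun x ↦ ⟨-h x, φ x⟩) hmul, continuous_mk (by fun_prop) (by fun_prop)⟩,
    fun _ ↦ rfl⟩

lemma mem_range_coboundary_of_section [ContinuousMul G] {T : G →ₜ* CocycleExt c}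
    (hT : ∀ x, (T x).base = x) : c ∈ LinearMap.range coboundary := by
  refine mem_range_coboundary_iff.2 ⟨⟨fun x ↦ -(T x).val, by fun_prop⟩, fun x y ↦ ?_⟩
  simp only [ContinuousMap.coe_mk, map_mul, mul_val, hT]
  ring

end CocycleExt

open CocycleExt

/-- The splittings of the extension over the factors multiply up to a splitting, because a
symmetric factor set makes the extension commutative. -/
lemma mem_range_coboundary_of_symmetric {G : Type*} [CommGroup G] [TopologicalSpace G]
    [ContinuousMul G] {ι : Type*} [Fintype ι] {N : ι → Type*} [∀ i, Group (N i)]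
    [∀ i, TopologicalSpace (N i)] [∀ i, ContinuousMul (N i)] (e : ∀ i, N i →ₜ* G)
    (q : ∀ i, G →ₜ* N i) (hprod : ∀ x, ∏ i, e i (q i x) = x) {f : contCocycles₂ R G}
    (hsymm : ∀ x y, f.1 (x, y) = f.1 (y, x))
    (hf : ∀ i, comap₂ (e i) f ∈ LinearMap.range coboundary) :
    f ∈ LinearMap.range coboundary := by
  let : CommGroup (CocycleExt f) :=
    { mul_comm x y := CocycleExt.ext
        (by rw [mul_val, mul_val, hsymm, add_comm x.val]) (mul_comm _ _) }
  choose S hS using fun i ↦ exists_lift_of_comap₂_mem_range_coboundary (hf i)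
  let T : G →ₜ* CocycleExt f :=
    { toFun x := ∏ i, S i (q i x)
      map_one' := by simp only [map_one, Finset.prod_const_one]
      map_mul' x y := by simp only [map_mul, Finset.prod_mul_distrib]
      continuous_toFun := by fun_prop }
  refine mem_range_coboundary_of_section (T := T) fun x ↦ ?_
  calc (T x).base = ∏ i, (S i (q i x)).base := map_prod (baseHom f) _ _
    _ = x := by simp only [hS, hprod]

section Inflation

variable {A : Type*} [CommRing A] [TopologicalSpace A] [IsTopologicalRing A]
  {c : contCocycles₂ A G}

lemma exists_comap₂_baseHom_eq {f : contCocycles₂ R (CocycleExt c)}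
    (hleft : ∀ a x, f.1 (scalar c a, x) = 0) (hright : ∀ x a, f.1 (x, scalar c a) = 0) :
    ∃ g, comap₂ (baseHom c) g = f := by
  have scalar_mul_left (a x y) : f.1 (scalar c a * x, y) = f.1 (x, y) := by
    simpa [hleft] using contCocycles₂_identity f (scalar c a) x y
  have scalar_mul_right (a x y) : f.1 (x, scalar c a * y) = f.1 (x, y) := by
    simpa [hright, (scalar_commute a y).eq] using (contCocycles₂_identity f x y (scalar c a)).symm
  have eq_sec (x y) : f.1 (x, y) = f.1 (sec c x.base, sec c y.base) := by
    rw [← scalar_mul_left (.ofAdd x.val) (sec c x.base),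
      ← scalar_mul_right (.ofAdd y.val) _ (sec c y.base), scalar_mul_sec, scalar_mul_sec]
  refine ⟨⟨⟨fun q ↦ f.1 (sec c q.1, sec c q.2), by fun_prop⟩, fun u v w ↦ ?_⟩,
    Subtype.ext <| ContinuousMap.ext fun q ↦ (eq_sec q.1 q.2).symm⟩
  have h := contCocycles₂_identity f (sec c u) (sec c v) (sec c w)
  rwa [eq_sec (_ * _), eq_sec _ (_ * _)] at h

variable [ContinuousMul G]

/-- A primitive `h₀` of the restriction of `f` to the kernel extends along the standard section to
`h (a * sec u) = h₀ a - f (a, sec u)`, up to a constant correcting `sec 1 ≠ 1`. -/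
lemma exists_coboundary_eq_on_scalar {f : contCocycles₂ R (CocycleExt c)}
    (hker : comap₂ (scalar c) f ∈ LinearMap.range coboundary) :
    ∃ h, ∀ a x, f.1 (scalar c a, x) = (coboundary h).1 (scalar c a, x) := by
  obtain ⟨h₀, hh₀⟩ := mem_range_coboundary_iff.1 hker
  simp only [comap₂_apply] at hh₀
  have sec_one : sec c 1 = scalar c (.ofAdd (c.1 (1, 1))) := CocycleExt.ext (by simp) rfl
  let h : C(CocycleExt c, R) :=
    ⟨fun x ↦ h₀ (.ofAdd x.val) - f.1 (scalar c (.ofAdd x.val), sec c x.base) +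
      h₀ (.ofAdd (c.1 (1, 1))), by fun_prop⟩
  have h_scalar (a : Multiplicative A) : h (scalar c a) = h₀ a := by
    have key := hh₀ (.ofAdd (a.toAdd - c.1 (1, 1))) (.ofAdd (c.1 (1, 1)))
    rw [← ofAdd_add, sub_add_cancel, ofAdd_toAdd, ← sec_one] at key
    change h₀ _ - f.1 (_, _) + h₀ _ = _
    rw [scalar_val, scalar_base, key]
    ring
  refine ⟨h, fun a x ↦ ?_⟩
  have key := contCocycles₂_identity f (scalar c a) (scalar c (.ofAdd x.val)) (sec c x.base)
  rw [scalar_mul_sec, ← map_mul, hh₀] at key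
  rw [coboundary_apply, h_scalar, scalar_mul]
  simp only [h, ContinuousMap.coe_mk, ofAdd_add, ofAdd_toAdd]
  linear_combination -key

lemma exists_sub_comap₂_baseHom_mem_range_coboundary {f : contCocycles₂ R (CocycleExt c)}
    (hsymm : ∀ a x, f.1 (scalar c a, x) = f.1 (x, scalar c a))
    (hker : comap₂ (scalar c) f ∈ LinearMap.range coboundary) :
    ∃ g, f - comap₂ (baseHom c) g ∈ LinearMap.range coboundary := by
  obtain ⟨h, hh⟩ := exists_coboundary_eq_on_scalar hker
  obtain ⟨g, hg⟩ := exists_comap₂_baseHom_eq (f := f - coboundary h)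
    (fun a x ↦ sub_eq_zero.2 (hh a x)) (fun x a ↦ sub_eq_zero.2 <| by
      rw [← hsymm, hh, coboundary_apply, coboundary_apply, (scalar_commute a x).eq, add_comm (h x)])
  exact ⟨g, h, by rw [hg, sub_sub_cancel]⟩

end Inflation

end Extension

section Padic

variable {p : ℕ} [Fact p.Prime]

lemma continuous_toZModPow (n : ℕ) : Continuous (PadicInt.toZModPow (p := p) n) := by
  refine continuous_of_continuousAt_zero _ ?_
  have hp : (0 : ℝ) < p := by exact_mod_cast (Fact.out : p.Prime).pos
  refine continuousAt_const.congr (f := fun _ ↦ 0) ?_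
  filter_upwards [Metric.ball_mem_nhds 0 (zpow_pos hp (-n : ℤ))] with x hx
  rw [eq_comm, ← RingHom.mem_ker, PadicInt.ker_toZModPow, ← PadicInt.norm_le_pow_iff_mem_span_pow]
  exact (mem_ball_zero_iff.1 hx).le

@[fun_prop]
lemma continuous_toZMod : Continuous (PadicInt.toZMod (p := p)) := by
  refine continuous_of_continuousAt_zero _ (continuousAt_const.congr (f := fun _ ↦ 0) ?_)
  filter_upwards [Metric.ball_mem_nhds 0 one_pos] with x hx
  rw [eq_comm, ← RingHom.mem_ker, PadicInt.ker_toZMod, IsLocalRing.mem_maximalIdeal,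
    PadicInt.mem_nonunits]
  exact mem_ball_zero_iff.1 hx

lemma exists_periodic_pow_of_continuous {X : Type*} [TopologicalSpace X] [DiscreteTopology X]
    {φ : ℤ_[p] → X} (hφ : Continuous φ) : ∃ N : ℕ, Function.Periodic φ ((p : ℤ_[p]) ^ N) := by
  obtain ⟨δ, hδ, h⟩ := lebesgue_number_lemma_of_metric (s := (Set.univ : Set ℤ_[p]))
    (c := fun i : X ↦ φ ⁻¹' {i}) isCompact_univ
    (fun i ↦ (isOpen_discrete {i}).preimage hφ) (fun x _ ↦ Set.mem_iUnion.2 ⟨φ x, rfl⟩)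
  obtain ⟨N, hN⟩ := PadicInt.exists_pow_neg_lt p hδ
  refine ⟨N, fun x ↦ ?_⟩
  obtain ⟨i, hi⟩ := h x (Set.mem_univ x)
  refine (hi ?_).trans (hi (Metric.mem_ball_self hδ)).symm
  rwa [Metric.mem_ball, dist_eq_norm, add_sub_cancel_left, PadicInt.norm_p_pow]

lemma exists_continuousMap_natCast_eq {X : Type*} [TopologicalSpace X] {g : ℕ → X} {N : ℕ}
    (hg : Function.Periodic g (p ^ N)) : ∃ h : C(ℤ_[p], X), ∀ n : ℕ, h n = g n := by
  refine ⟨⟨fun x ↦ g (PadicInt.toZModPow N x).val,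
    (continuous_of_discreteTopology (f := fun a : ZMod (p ^ N) ↦ g a.val)).comp
      (continuous_toZModPow N)⟩, fun n ↦ ?_⟩
  rw [ContinuousMap.coe_mk, map_natCast, ZMod.val_natCast, hg.map_mod_nat]

lemma periodic_sum_range {A : Type*} [AddCommMonoid A] {φ : ℕ → A} {m n : ℕ}
    (hφ : Function.Periodic φ m) (hn : ∀ a : A, n • a = 0) :
    Function.Periodic (fun k ↦ ∑ i ∈ Finset.range k, φ i) (n * m) := by
  have shift (k i : ℕ) : φ (k * m + i) = φ i := by
    rw [add_comm]
    exact hφ.nat_mul k i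
  have sum_mul (k : ℕ) : ∑ i ∈ Finset.range (k * m), φ i = k • ∑ i ∈ Finset.range m, φ i := by
    induction k with
    | zero => simp
    | succ k ih =>
      rw [add_mul, one_mul, Finset.sum_range_add, ih, succ_nsmul]
      simp only [shift]
  intro k
  simp only [add_comm k, Finset.sum_range_add, sum_mul, hn, zero_add, shift]

/-- On the dense subgroup generated by `1` the cocycle is the coboundary of a partial sum of the
periodic function `k ↦ f (k, 1)`. Over `p` periods this sum vanishes, so the primitive is itself
periodic and extends to `ℤ_p`. -/
lemma mem_range_coboundary_padicInt {R : Type*} [CommRing R] [TopologicalSpace R]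
    [DiscreteTopology R] [CharP R p] (f : contCocycles₂ R (Multiplicative ℤ_[p])) :
    f ∈ LinearMap.range coboundary := by
  have hx (n : ℕ) : (Multiplicative.ofAdd (1 : ℤ_[p])) ^ n = .ofAdd (n : ℤ_[p]) := by
    rw [← ofAdd_nsmul, nsmul_one]
  let φ : ℤ_[p] → R := fun a ↦ f.1 (.ofAdd a, .ofAdd 1)
  have φ_continuous : Continuous φ :=
    f.1.continuous.comp (continuous_ofAdd.prodMk continuous_const)
  obtain ⟨N, hN⟩ := exists_periodic_pow_of_continuous φ_continuous
  have hφ : Function.Periodic (fun k : ℕ ↦ φ k) (p ^ N) := fun k ↦ by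
    simpa using hN k
  have hsum := periodic_sum_range hφ (n := p) fun a ↦ by
    rw [nsmul_eq_mul, CharP.cast_eq_zero, zero_mul]
  rw [← pow_succ'] at hsum
  obtain ⟨h, hh⟩ := exists_continuousMap_natCast_eq
    (hsum.comp fun s ↦ f.1 (1, 1) - s)
  have hnat (a b : ℕ) : f.1 (.ofAdd (a : ℤ_[p]), .ofAdd (b : ℤ_[p])) =
      h a + h b - h (a + b : ℕ) := by
    simp only [hh, Function.comp_apply, φ, ← hx]
    exact cocycle_pow_pow f _ a b
  have hdense := (PadicInt.denseRange_natCast (p := p)).prodMap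
    (PadicInt.denseRange_natCast (p := p))
  have heq : (fun q : ℤ_[p] × ℤ_[p] ↦ f.1 (.ofAdd q.1, .ofAdd q.2)) =
      fun q ↦ h q.1 + h q.2 - h (q.1 + q.2) := by
    refine hdense.equalizer ?_ (by fun_prop) (funext fun q ↦ ?_)
    · exact f.1.continuous.comp ((continuous_ofAdd.comp continuous_fst).prodMk
        (continuous_ofAdd.comp continuous_snd))
    · simpa using hnat q.1 q.2
  exact mem_range_coboundary_iff.2 ⟨⟨fun x ↦ h x.toAdd, by fun_prop⟩,
    fun x y ↦ congr_fun heq (x.toAdd, y.toAdd)⟩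

section AddHom

variable {V : Type*} [AddCommGroup V] [Module (ZMod p) V]

lemma addMonoidHom_padicInt_apply (χ : ℤ_[p] →+ V) (x : ℤ_[p]) :
    χ x = PadicInt.toZMod x • χ 1 := by
  have hp (y : ℤ_[p]) : χ (p * y) = 0 := by
    rw [← nsmul_eq_mul, map_nsmul, ← Nat.cast_smul_eq_nsmul (ZMod p), CharP.cast_eq_zero, zero_smul]
  obtain ⟨n, y, rfl⟩ : ∃ (n : ℕ) (y : ℤ_[p]), x = p * y + n := by
    obtain ⟨y, hy⟩ := Ideal.mem_span_singleton.1 (PadicInt.appr_spec 1 x)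
    exact ⟨x.appr 1, y, by rw [← sub_eq_iff_eq_add, hy, pow_one]⟩
  rw [map_add, hp, zero_add, ← nsmul_one, map_nsmul, ← Nat.cast_smul_eq_nsmul (ZMod p)]
  simp

variable {ι : Type*} [Fintype ι] [DecidableEq ι]

lemma addMonoidHom_pi_padicInt_apply (χ : (ι → ℤ_[p]) →+ V) (u : ι → ℤ_[p]) :
    χ u = ∑ i, PadicInt.toZMod (u i) • χ (Pi.single i 1) := by
  conv_lhs => rw [← Finset.univ_sum_single u, map_sum]
  exact Finset.sum_congr rfl fun i _ ↦
    addMonoidHom_padicInt_apply (χ.comp (AddMonoidHom.single (fun _ : ι ↦ ℤ_[p]) i)) (u i)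

end AddHom

section Matrix

variable {ι : Type*}

/-- Reduction modulo `p` of the coordinates. -/
def modP : (ι → ℤ_[p]) →+* (ι → ZMod p) :=
  PadicInt.toZMod.compLeft ι

@[simp]
lemma modP_apply (u : ι → ℤ_[p]) (i : ι) : modP u i = PadicInt.toZMod (u i) := rfl

@[fun_prop]
lemma continuous_modP : Continuous (modP : (ι → ℤ_[p]) → ι → ZMod p) :=
  continuous_pi fun i ↦ continuous_toZMod.comp (continuous_apply i)

@[simp]
lemma modP_single [DecidableEq ι] (i : ι) :
    modP (Pi.single i 1 : ι → ℤ_[p]) = Pi.single i 1 := by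
  ext j
  simp [Pi.single_apply, apply_ite]

lemma mem_range_coboundary_of_symmetric_pi_padicInt [Finite ι] {R : Type*} [CommRing R]
    [TopologicalSpace R] [DiscreteTopology R] [CharP R p]
    {f : contCocycles₂ R (Multiplicative (ι → ℤ_[p]))}
    (hf : ∀ x y, f.1 (x, y) = f.1 (y, x)) : f ∈ LinearMap.range coboundary := by
  classical
  have := Fintype.ofFinite ι
  let e (i : ι) : Multiplicative ℤ_[p] →ₜ* Multiplicative (ι → ℤ_[p]) :=
    ⟨(AddMonoidHom.single (fun _ ↦ ℤ_[p]) i).toMultiplicative,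
      continuous_ofAdd.comp ((continuous_single (A := fun _ ↦ ℤ_[p]) i).comp continuous_toAdd)⟩
  let q (i : ι) : Multiplicative (ι → ℤ_[p]) →ₜ* Multiplicative ℤ_[p] :=
    ⟨(Pi.evalAddMonoidHom (fun _ ↦ ℤ_[p]) i).toMultiplicative,
      continuous_ofAdd.comp ((continuous_apply i).comp continuous_toAdd)⟩
  refine mem_range_coboundary_of_symmetric e q (fun x ↦ ?_) hf
    fun i ↦ mem_range_coboundary_padicInt _
  exact congrArg Multiplicative.ofAdd (Finset.univ_sum_single x.toAdd)

/-- The commutator pairing `(a, b) ↦ f (a, b) - f (b, a)` of a `2`-cocycle on a commutative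
group. -/
def commutatorPairing {R A : Type*} [CommRing R] [TopologicalSpace R] [IsTopologicalRing R]
    [AddCommGroup A] [TopologicalSpace A] (f : contCocycles₂ R (Multiplicative A)) :
    A →+ A →+ R :=
  AddMonoidHom.mk' (fun a ↦ AddMonoidHom.mk'
      (fun b ↦ f.1 (.ofAdd a, .ofAdd b) - f.1 (.ofAdd b, .ofAdd a)) fun b b' ↦ by
        rw [ofAdd_add]
        linear_combination -cocycle_sub_swap_mul f
          (Commute.all (Multiplicative.ofAdd b) (Multiplicative.ofAdd a))
          (Commute.all (Multiplicative.ofAdd b') (Multiplicative.ofAdd a)))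
    fun a a' ↦ AddMonoidHom.ext fun b ↦ by
      simpa using cocycle_sub_swap_mul f
        (Commute.all (Multiplicative.ofAdd a) (Multiplicative.ofAdd b))
        (Commute.all (Multiplicative.ofAdd a') (Multiplicative.ofAdd b))

variable [Fintype ι]

/-- The linear `1`-cocycle `u ↦ ∑ i, aᵢ uᵢ` on `ℤ_p^ι` with values in `𝔽_p`. -/
def linearCocycle :
    (ι → ZMod p) →ₗ[ZMod p] contCocycles₁ (ZMod p) (Multiplicative (ι → ℤ_[p])) where
  toFun a := ⟨⟨fun x ↦ a ⬝ᵥ modP x.toAdd,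
    continuous_const.dotProduct (continuous_modP.comp continuous_toAdd)⟩, fun x y ↦ by
      simp only [ContinuousMap.coe_mk, toAdd_mul, map_add, dotProduct_add]⟩
  map_add' a b := Subtype.ext <| ContinuousMap.ext fun x ↦ add_dotProduct a b _
  map_smul' r a := Subtype.ext <| ContinuousMap.ext fun x ↦ smul_dotProduct r a _

@[simp]
lemma linearCocycle_apply (a : ι → ZMod p) (x : Multiplicative (ι → ℤ_[p])) :
    (linearCocycle a).1 x = a ⬝ᵥ modP x.toAdd := rfl

/-- The bilinear `2`-cocycle `(u, v) ↦ ∑ i j, cᵢⱼ uᵢ vⱼ` on `ℤ_p^ι` with values in `𝔽_p`. -/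
def matrixCocycle :
    Matrix ι ι (ZMod p) →ₗ[ZMod p] contCocycles₂ (ZMod p) (Multiplicative (ι → ℤ_[p])) where
  toFun c := ⟨⟨fun q ↦ modP q.1.toAdd ⬝ᵥ c.mulVec (modP q.2.toAdd),
      (continuous_modP.comp (continuous_toAdd.comp continuous_fst)).dotProduct
        (continuous_const.matrix_mulVec
          (continuous_modP.comp (continuous_toAdd.comp continuous_snd)))⟩, fun x y z ↦ by
      simp only [ContinuousMap.coe_mk, toAdd_mul, map_add, add_dotProduct, Matrix.mulVec_add,
        dotProduct_add]
      ring⟩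
  map_add' c d := Subtype.ext <| ContinuousMap.ext fun q ↦ by
    simp [Matrix.add_mulVec]
  map_smul' a c := Subtype.ext <| ContinuousMap.ext fun q ↦ by
    simp [Matrix.smul_mulVec]

@[simp]
lemma matrixCocycle_apply (c : Matrix ι ι (ZMod p)) (x y : Multiplicative (ι → ℤ_[p])) :
    (matrixCocycle c).1 (x, y) = modP x.toAdd ⬝ᵥ c.mulVec (modP y.toAdd) := rfl

lemma matrixCocycle_single_single [DecidableEq ι] (c : Matrix ι ι (ZMod p)) (i j : ι) :
    (matrixCocycle c).1 (.ofAdd (Pi.single i 1), .ofAdd (Pi.single j 1)) = c i j := by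
  simp

lemma matrixCocycle_vecMulVec (a b : ι → ZMod p) (x y : Multiplicative (ι → ℤ_[p])) :
    (matrixCocycle (Matrix.vecMulVec a b)).1 (x, y) =
      (linearCocycle a).1 x * (linearCocycle b).1 y := by
  rw [matrixCocycle_apply, Matrix.vecMulVec_mulVec, linearCocycle_apply, linearCocycle_apply,
    op_smul_eq_smul, dotProduct_smul, smul_eq_mul, dotProduct_comm a, mul_comm]

lemma matrixCocycle_transpose_apply (c : Matrix ι ι (ZMod p))
    (x y : Multiplicative (ι → ℤ_[p])) :
    (matrixCocycle c.transpose).1 (x, y) = (matrixCocycle c).1 (y, x) := by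
  rw [matrixCocycle_apply, matrixCocycle_apply, Matrix.mulVec_transpose, dotProduct_comm,
    Matrix.dotProduct_mulVec]

lemma matrixCocycle_mem_range_coboundary {c : Matrix ι ι (ZMod p)} (hc : c.IsSymm) :
    matrixCocycle c ∈ LinearMap.range coboundary :=
  mem_range_coboundary_of_symmetric_pi_padicInt fun x y ↦ by
    rw [← matrixCocycle_transpose_apply, hc.eq]

lemma matrixCocycle_commutatorPairing [DecidableEq ι]
    (f : contCocycles₂ (ZMod p) (Multiplicative (ι → ℤ_[p])))
    (x y : Multiplicative (ι → ℤ_[p])) :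
    (matrixCocycle (Matrix.of fun i j ↦ commutatorPairing f (Pi.single i 1) (Pi.single j 1))).1
      (x, y) = f.1 (x, y) - f.1 (y, x) := by
  have h : f.1 (x, y) - f.1 (y, x) = commutatorPairing f x.toAdd y.toAdd := rfl
  rw [h, addMonoidHom_pi_padicInt_apply (commutatorPairing f), AddMonoidHom.finsetSum_apply]
  refine Finset.sum_congr rfl fun i _ ↦ ?_
  rw [AddMonoidHom.smul_apply, smul_eq_mul,
    addMonoidHom_pi_padicInt_apply (commutatorPairing f (Pi.single i 1))]
  simp [Matrix.mulVec, dotProduct, mul_comm]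

/-- Away from `p = 2`, half the commutator pairing of `f` has the same commutator pairing as `f`. -/
lemma exists_sub_matrixCocycle_mem_range_coboundary (hp : p ≠ 2)
    (f : contCocycles₂ (ZMod p) (Multiplicative (ι → ℤ_[p]))) :
    ∃ c, f - matrixCocycle c ∈ LinearMap.range coboundary := by
  classical
  let M : Matrix ι ι (ZMod p) :=
    Matrix.of fun i j ↦ commutatorPairing f (Pi.single i 1) (Pi.single j 1)
  have two_ne_zero : (2 : ZMod p) ≠ 0 := by
    rw [← Nat.cast_two, Ne, ZMod.natCast_eq_zero_iff, Nat.prime_dvd_prime_iff_eq Fact.out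
      Nat.prime_two]
    exact hp
  refine ⟨(2 : ZMod p)⁻¹ • M, mem_range_coboundary_of_symmetric_pi_padicInt fun x y ↦ ?_⟩
  have hxy := matrixCocycle_commutatorPairing f x y
  have hyx := matrixCocycle_commutatorPairing f y x
  rw [map_smul]
  change f.1 (x, y) - 2⁻¹ * (matrixCocycle M).1 (x, y) =
    f.1 (y, x) - 2⁻¹ * (matrixCocycle M).1 (y, x)
  rw [hxy, hyx]
  linear_combination -(f.1 (x, y) - f.1 (y, x)) * inv_mul_cancel₀ two_ne_zero

end Matrix

end Padic

namespace CocycleExt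

variable {R : Type*} [CommRing R] [TopologicalSpace R] [IsTopologicalRing R]
  {G : Type*} [Group G] [TopologicalSpace G] {c : contCocycles₂ R G}

lemma eq_one_of_isOfFinOrder [IsAddTorsionFree R] [IsMulTorsionFree G] {x : CocycleExt c}
    (hx : IsOfFinOrder x) : x = 1 := by
  have x_mem_ker : x ∈ (baseHom c : CocycleExt c →* G).ker :=
    (isOfFinOrder_iff_eq_one _).1 ((baseHom c : CocycleExt c →* G).isOfFinOrder hx)
  rw [← range_scalar] at x_mem_ker
  obtain ⟨a, rfl⟩ := x_mem_ker
  have ha := (scalar_injective (c := c)).isOfFinOrder_iff.1 hx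
  rw [(isOfFinOrder_iff_eq_one a).1 ha, map_one]

lemma inv_scalar_mul (x : CocycleExt c) :
    (scalar c (.ofAdd (x.val + c.1 (1, 1))))⁻¹ * x = (sec c 1)⁻¹ * sec c x.base := by
  have scalar_eq : scalar c (.ofAdd (x.val + c.1 (1, 1))) = scalar c (.ofAdd x.val) * sec c 1 := by
    rw [scalar_mul]
    exact CocycleExt.ext (by simp) rfl
  rw [inv_mul_eq_iff_eq_mul, scalar_eq, mul_assoc, mul_inv_cancel_left, scalar_mul_sec]

open Filter Topology in
/-- Modulo an open subgroup a suitable `p`-power of `x` is the image of a scalar. -/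
lemma isPGroup_quotient [IsTopologicalGroup G] {p : ℕ}
    (hR : ∀ a : R, Tendsto (fun n : ℕ ↦ p ^ n • a) atTop (𝓝 0))
    (hG : ∀ x : G, Tendsto (fun n : ℕ ↦ x ^ p ^ n) atTop (𝓝 1))
    (U : OpenNormalSubgroup (CocycleExt c)) : IsPGroup p (CocycleExt c ⧸ U.toSubgroup) := by
  rintro ⟨x⟩
  have tendsto_sec : Tendsto (fun n : ℕ ↦ (sec c 1)⁻¹ * sec c (x.base ^ p ^ n)) atTop (𝓝 1) := by
    simpa using (((sec c).continuous.tendsto 1).comp (hG x.base)).const_mul (sec c 1)⁻¹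
  obtain ⟨n, hn⟩ := (tendsto_sec.eventually (U.isOpen'.mem_nhds U.one_mem')).exists
  obtain ⟨a, ha⟩ : ∃ a, (scalar c a)⁻¹ * x ^ p ^ n ∈ U.toSubgroup := by
    refine ⟨.ofAdd ((x ^ p ^ n).val + c.1 (1, 1)), ?_⟩
    rw [inv_scalar_mul, ← baseHom_apply, map_pow]
    exact hn
  have tendsto_scalar : Tendsto (fun m : ℕ ↦ scalar c a ^ p ^ m) atTop (𝓝 1) := by
    have h := ((map_continuous (scalar c)).tendsto 1).comp
      ((continuous_ofAdd.tendsto 0).comp (hR a.toAdd))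
    rw [map_one] at h
    exact h.congr fun m ↦ map_pow (scalar c) a (p ^ m)
  obtain ⟨m, hm⟩ := (tendsto_scalar.eventually (U.isOpen'.mem_nhds U.one_mem')).exists
  refine ⟨n + m, ?_⟩
  calc (x : CocycleExt c ⧸ U.toSubgroup) ^ p ^ (n + m)
      = ((x ^ p ^ n : CocycleExt c) : CocycleExt c ⧸ U.toSubgroup) ^ p ^ m := by
        rw [pow_add, pow_mul, QuotientGroup.mk_pow]
    _ = (scalar c a : CocycleExt c ⧸ U.toSubgroup) ^ p ^ m := by rw [QuotientGroup.eq.2 ha]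
    _ = 1 := (QuotientGroup.eq_one_iff _).2 hm

/-- An action on the quotient that preserves the factor set lifts to the extension, acting
trivially on the kernel. -/
@[reducible]
def mulDistribMulAction {C : Type*} [Group C] (φ : C →* MulAut G)
    (hφ : ∀ g x y, c.1 (φ g x, φ g y) = c.1 (x, y)) :
    MulDistribMulAction C (CocycleExt c) where
  smul g x := ⟨x.val, φ g x.base⟩
  one_smul x := CocycleExt.ext rfl (by
    change φ 1 x.base = x.base
    rw [map_one, MulAut.one_apply])
  mul_smul g g' x := CocycleExt.ext rfl (by
    change φ (g * g') x.base = φ g (φ g' x.base)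
    rw [map_mul, MulAut.mul_apply])
  smul_one g := CocycleExt.ext rfl (map_one (φ g))
  smul_mul g x y := CocycleExt.ext (congrArg (x.val + y.val + ·) (hφ g x.base y.base).symm)
    (map_mul (φ g) x.base y.base)

end CocycleExt

open CocycleExt

section CupCocycle

variable {n : ℕ}

/-- `C` acts on functions on `ℤ/n` by cyclic shifts through a character `C → ℤ/n`. -/
def shift {C : Type*} [Group C] (κ : C →* Multiplicative (ZMod n)) (A : Type*) [AddGroup A] :
    C →* MulAut (Multiplicative (ZMod n → A)) where
  toFun g := (AddEquiv.arrowCongr (Equiv.subRight (κ g).toAdd) (AddEquiv.refl A)).toMultiplicative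
  map_one' := MulEquiv.ext fun x ↦ funext fun i ↦ by
    change x.toAdd (i + (κ 1).toAdd) = x.toAdd i
    rw [map_one, toAdd_one, add_zero]
  map_mul' g h := MulEquiv.ext fun x ↦ funext fun i ↦ by
    change x.toAdd (i + (κ (g * h)).toAdd) = x.toAdd (i + (κ g).toAdd + (κ h).toAdd)
    rw [map_mul, toAdd_mul, add_assoc]

@[simp]
lemma shift_apply {C : Type*} [Group C] (κ : C →* Multiplicative (ZMod n)) {A : Type*}
    [AddGroup A] (g : C) (x : Multiplicative (ZMod n → A)) (i : ZMod n) :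
    (shift κ A g x).toAdd i = x.toAdd (i + (κ g).toAdd) := rfl

variable [NeZero n] {R : Type*} [CommRing R] [TopologicalSpace R] [IsTopologicalRing R]

/-- The cup product `∑ i, yᵢ ∪ yᵢ₊₁` of the coordinates `yᵢ` of `R ^ (ℤ/n)`. -/
def cupCocycle (n : ℕ) [NeZero n] (R : Type*) [CommRing R] [TopologicalSpace R]
    [IsTopologicalRing R] : contCocycles₂ R (Multiplicative (ZMod n → R)) :=
  ⟨⟨fun q ↦ ∑ i, q.1.toAdd i * q.2.toAdd (i + 1), by
    have h (j : ZMod n) : Continuous fun x : Multiplicative (ZMod n → R) ↦ x.toAdd j :=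
      (continuous_apply j).comp continuous_toAdd
    exact continuous_finsetSum _ fun i _ ↦
      ((h i).comp continuous_fst).mul ((h (i + 1)).comp continuous_snd)⟩, fun x y z ↦ by
    simp only [ContinuousMap.coe_mk, toAdd_mul, Pi.add_apply, add_mul, mul_add,
      Finset.sum_add_distrib]
    ring⟩

lemma cupCocycle_apply (x y : Multiplicative (ZMod n → R)) :
    (cupCocycle n R).1 (x, y) = ∑ i, x.toAdd i * y.toAdd (i + 1) := rfl

lemma cupCocycle_single_single (i j : ZMod n) :
    (cupCocycle n R).1 (.ofAdd (Pi.single i 1), .ofAdd (Pi.single j 1)) =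
      if j = i + 1 then 1 else 0 := by
  rw [cupCocycle_apply, Finset.sum_eq_single_of_mem i (Finset.mem_univ i) fun k _ hk ↦ by
    rw [toAdd_ofAdd, Pi.single_eq_of_ne hk, zero_mul]]
  simp [Pi.single_apply, eq_comm]

lemma cupCocycle_shift {C : Type*} [Group C] (κ : C →* Multiplicative (ZMod n)) (g : C)
    (x y : Multiplicative (ZMod n → R)) :
    (cupCocycle n R).1 (shift κ R g x, shift κ R g y) = (cupCocycle n R).1 (x, y) := by
  simp only [cupCocycle_apply, shift_apply, add_right_comm _ (1 : ZMod n)]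
  exact Equiv.sum_comp (Equiv.addRight (κ g).toAdd) fun i ↦ x.toAdd i * y.toAdd (i + 1)

end CupCocycle

section CupExt

variable (p : ℕ) [Fact p.Prime]

/-- The central extension of `ℤ_p ^ (ℤ/p)` by `ℤ_p` with class `∑ i, yᵢ ∪ yᵢ₊₁`. -/
abbrev CupExt : Type := CocycleExt (cupCocycle p ℤ_[p])

lemma cupExt_isProP : IsProP p (.of (CupExt p)) := by
  have tendsto_pow (a : ℤ_[p]) : Filter.Tendsto (fun n : ℕ ↦ p ^ n • a) .atTop (nhds 0) := by
    have hp : ‖(p : ℤ_[p])‖ < 1 := PadicInt.norm_p (p := p) ▸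
      inv_lt_one_of_one_lt₀ (mod_cast (Fact.out : p.Prime).one_lt)
    simpa using (tendsto_pow_atTop_nhds_zero_of_norm_lt_one hp).mul_const a
  refine isPGroup_quotient tendsto_pow fun x ↦ ?_
  exact (continuous_ofAdd.tendsto 0).comp (tendsto_pi_nhds.2 fun i ↦ tendsto_pow (x.toAdd i))

variable {p} {C : Type*} [Group C] (κ : C →* Multiplicative (ZMod p))

/-- The action of `C` on `CupExt p` by cyclic shifts of the coordinates of the quotient. -/
@[reducible]
def cupAction : MulDistribMulAction C (CupExt p) :=
  mulDistribMulAction (shift κ ℤ_[p]) (cupCocycle_shift κ)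

lemma cupAction_continuousConstSMul :
    letI := cupAction κ
    ContinuousConstSMul C (CupExt p) :=
  letI := cupAction κ
  ⟨fun g ↦ CocycleExt.continuous_mk continuous_val <| continuous_ofAdd.comp <|
    continuous_pi fun i ↦ (continuous_apply (i + (κ g).toAdd)).comp <|
      continuous_toAdd.comp continuous_base⟩

lemma cupAction_smul (g : C) (x : CupExt p) :
    letI := cupAction κ
    g • x = ⟨x.val, shift κ ℤ_[p] g x.base⟩ := rfl

lemma isCyclicCupExtension {κ : C →* Multiplicative (ZMod p)} {σ : C} (hσ : κ σ = .ofAdd 1) :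
    letI := cupAction κ
    IsCyclicCupExtension p σ (CupExt p) := by
  let := cupAction κ
  have shift_σ (x : Multiplicative (ZMod p → ℤ_[p])) (i : ZMod p) :
      (shift κ ℤ_[p] σ x).toAdd i = x.toAdd (i + 1) := by
    rw [shift_apply, hσ, toAdd_ofAdd]
  refine ⟨scalar _, baseHom _, (sec _).comp ⟨Multiplicative.ofAdd, continuous_ofAdd⟩,
    scalar_injective, fun u ↦ ⟨sec _ u, rfl⟩, range_scalar, ?_, fun _ ↦ rfl,
    ?_, fun a ↦ ?_, fun x i ↦ ?_, fun u ↦ ?_⟩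
  · rintro _ ⟨a, rfl⟩
    exact Subgroup.mem_center_iff.2 fun x ↦ (scalar_commute a x).eq.symm
  · exact fun u v ↦ sec_mul_sec (c := cupCocycle p ℤ_[p]) (.ofAdd u) (.ofAdd v)
  · rw [cupAction_smul, scalar_base, map_one]
    rfl
  · rw [cupAction_smul]
    exact shift_σ x.base i
  · rw [cupAction_smul]
    exact CocycleExt.ext rfl (funext fun i ↦ shift_σ (.ofAdd u) i)

end CupExt

section ShiftMatrix

/-- The matrix of the cyclic form `∑ i, uᵢ vᵢ₊₁`. -/
def shiftMatrix (n : ℕ) (R : Type*) [Zero R] [One R] : Matrix (ZMod n) (ZMod n) R :=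
  .of fun i j ↦ if j = i + 1 then 1 else 0

lemma shiftMatrix_apply {n : ℕ} {R : Type*} [Zero R] [One R] (i j : ZMod n) :
    shiftMatrix n R i j = if j = i + 1 then 1 else 0 := rfl

end ShiftMatrix

namespace CupExt

variable {p : ℕ} [Fact p.Prime]

lemma natCast_ne_zero {n : ℕ} (hn : 0 < n) (hnp : n < p) : (n : ZMod p) ≠ 0 := by
  rw [Ne, ZMod.natCast_eq_zero_iff]
  exact Nat.not_dvd_of_pos_of_lt hn hnp

/-- The lift to `CupExt p` of the `i`-th standard generator of `ℤ_p ^ (ℤ/p)`. -/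
def gen (i : ZMod p) : CupExt p := sec _ (.ofAdd (Pi.single i 1))

lemma commutatorElement_gen_succ (hp : 2 < p) (i : ZMod p) :
    ⁅gen i, gen (i + 1)⁆ = scalar _ (.ofAdd 1) := by
  have h : i ≠ i + 1 + 1 := fun h ↦ natCast_ne_zero (p := p) two_pos hp (by
    push_cast
    linear_combination -h)
  rw [gen, gen, commutatorElement_sec (Commute.all _ _), cupCocycle_single_single,
    cupCocycle_single_single, if_pos rfl, if_neg h, sub_zero]

lemma commute_gen {i j : ZMod p} (hij : j ≠ i + 1) (hji : i ≠ j + 1) :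
    Commute (gen i) (gen j) :=
  sec_commute (Commute.all _ _) (by
    rw [cupCocycle_single_single, cupCocycle_single_single, if_neg hij, if_neg hji])

section Hom

variable {V : Type*} [AddCommGroup V] [Module (ZMod p) V]

lemma addMonoidHom_scalar (hp : 2 < p) (χ : Additive (CupExt p) →+ V)
    (a : Multiplicative ℤ_[p]) : χ (.ofMul (scalar _ a)) = 0 := by
  have h_one : χ (.ofMul (scalar _ (.ofAdd 1))) = 0 := by
    have h : AddMonoidHom.toMultiplicativeRight χ (scalar _ (.ofAdd 1)) = 1 := by
      rw [← commutatorElement_gen_succ hp 0, map_commutatorElement,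
        commutatorElement_eq_one_iff_mul_comm, mul_comm]
    exact h
  have h := addMonoidHom_padicInt_apply
    (χ.comp (MonoidHom.toAdditive (scalar (cupCocycle p ℤ_[p])).toMonoidHom)) a.toAdd
  exact h.trans ((congrArg _ h_one).trans (smul_zero _))

lemma addMonoidHom_apply (hp : 2 < p) (χ : Additive (CupExt p) →+ V) (x : CupExt p) :
    χ (.ofMul x) = ∑ i, modP x.base.toAdd i • χ (.ofMul (gen i)) := by
  have hsec (u v : ZMod p → ℤ_[p]) : χ (.ofMul (sec _ (.ofAdd (u + v)))) =
      χ (.ofMul (sec _ (.ofAdd u))) + χ (.ofMul (sec _ (.ofAdd v))) := by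
    rw [ofAdd_add, ← map_add, ← ofMul_mul, sec_mul_sec, ofMul_mul, map_add, addMonoidHom_scalar hp,
      zero_add]
  have hx : χ (.ofMul x) = χ (.ofMul (sec _ x.base)) := by
    rw [← scalar_mul_sec x, ofMul_mul, map_add, addMonoidHom_scalar hp, zero_add, scalar_mul_sec]
  rw [hx]
  exact addMonoidHom_pi_padicInt_apply
    (AddMonoidHom.mk' (fun u ↦ χ (.ofMul (sec _ (.ofAdd u)))) hsec) x.base.toAdd

end Hom

section Central

variable (f : contCocycles₂ (ZMod p) (CupExt p))

/-- `gen k` commutes with `gen (k + 2)` and `gen (k + 3)`, whose commutator generates the kernel of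
the extension. -/
lemma cocycle_scalar_one_gen (hp : 3 < p) (k : ZMod p) :
    f.1 (scalar _ (.ofAdd 1), gen k) = f.1 (gen k, scalar _ (.ofAdd 1)) := by
  have hp' : 4 < p := lt_of_le_of_ne hp fun h ↦ absurd (h ▸ (Fact.out : p.Prime)) (by norm_num)
  have h₁ := natCast_ne_zero (p := p) (n := 1) (by norm_num) (by omega)
  have h₂ := natCast_ne_zero (p := p) (n := 2) (by norm_num) (by omega)
  have h₃ := natCast_ne_zero (p := p) (n := 3) (by norm_num) (by omega)
  have h₄ := natCast_ne_zero (p := p) (n := 4) (by norm_num) (by omega)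
  push_cast at h₁ h₂ h₃ h₄
  rw [← commutatorElement_gen_succ (by omega) (k + 2)]
  refine cocycle_commutatorElement_swap f (commute_gen ?_ ?_) (commute_gen ?_ ?_) <;> intro h
  · exact h₃ (by linear_combination -h)
  · exact h₁ (by linear_combination h)
  · exact h₄ (by linear_combination -h)
  · exact h₂ (by linear_combination h)

lemma cocycle_scalar_one (hp : 3 < p) (x : CupExt p) :
    f.1 (scalar _ (.ofAdd 1), x) = f.1 (x, scalar _ (.ofAdd 1)) := by
  let χ : Additive (CupExt p) →+ ZMod p := AddMonoidHom.mk'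
    (fun x ↦ f.1 (x.toMul, scalar _ (.ofAdd 1)) - f.1 (scalar _ (.ofAdd 1), x.toMul))
    fun x y ↦ cocycle_sub_swap_mul f (scalar_commute _ x.toMul).symm (scalar_commute _ y.toMul).symm
  have hχ : χ (.ofMul x) = 0 := (addMonoidHom_apply (by omega) χ x).trans <|
    Finset.sum_eq_zero fun i _ ↦ smul_eq_zero_of_right _ <|
      sub_eq_zero.2 (cocycle_scalar_one_gen f hp i).symm
  exact (sub_eq_zero.1 hχ).symm

lemma cocycle_scalar_swap (hp : 3 < p) (a : Multiplicative ℤ_[p]) (x : CupExt p) :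
    f.1 (scalar _ a, x) = f.1 (x, scalar _ a) := by
  let χ : ℤ_[p] →+ ZMod p := AddMonoidHom.mk'
    (fun a ↦ f.1 (scalar _ (.ofAdd a), x) - f.1 (x, scalar _ (.ofAdd a))) fun a b ↦ by
      rw [ofAdd_add, map_mul]
      exact cocycle_sub_swap_mul f (scalar_commute _ x) (scalar_commute _ x)
  have hχ : χ 1 = 0 := sub_eq_zero.2 (cocycle_scalar_one f hp x)
  have h := addMonoidHom_padicInt_apply χ a.toAdd
  rw [hχ, smul_zero] at h
  exact sub_eq_zero.1 h

end Central

/-- The class of `∑ i, aᵢ yᵢ` in `H¹`. -/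
def linearClass : (ZMod p → ZMod p) →ₗ[ZMod p] H p (CupExt p) 1 :=
  H1π p (CupExt p) ∘ₗ comap₁ (baseHom _) ∘ₗ linearCocycle

lemma linearClass_bijective (hp : 2 < p) :
    Function.Bijective (linearClass : (ZMod p → ZMod p) →ₗ[ZMod p] H p (CupExt p) 1) := by
  refine ⟨H1π_injective.comp fun a b hab ↦ funext fun i ↦ ?_, fun ξ ↦ ?_⟩
  · have h := congrArg (fun h : contCocycles₁ (ZMod p) (CupExt p) ↦ h.1 (gen i)) hab
    simpa [gen] using h
  · obtain ⟨h, rfl⟩ := H1π_surjective ξ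
    refine ⟨fun i ↦ h.1 (gen i), congrArg (H1π p (CupExt p)) <| Subtype.ext <|
      ContinuousMap.ext fun x ↦ ?_⟩
    have hx := addMonoidHom_apply (by omega)
      (AddMonoidHom.mk' (fun x ↦ h.1 x.toMul) fun x y ↦ contCocycles₁_mul h x.toMul y.toMul) x
    exact (dotProduct_comm _ _).trans hx.symm

/-- The class of `∑ i j, cᵢⱼ yᵢ ∪ yⱼ` in `H²`. -/
def cupClass : Matrix (ZMod p) (ZMod p) (ZMod p) →ₗ[ZMod p] H p (CupExt p) 2 :=
  H2π p (CupExt p) ∘ₗ comap₂ (baseHom _) ∘ₗ matrixCocycle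

lemma cupClass_surjective (hp : 3 < p) :
    Function.Surjective (cupClass : Matrix (ZMod p) (ZMod p) (ZMod p) → H p (CupExt p) 2) := by
  intro ξ
  obtain ⟨f, rfl⟩ := H2π_surjective ξ
  obtain ⟨g, hg⟩ := exists_sub_comap₂_baseHom_mem_range_coboundary (cocycle_scalar_swap f hp)
    (mem_range_coboundary_padicInt _)
  obtain ⟨c, hc⟩ := exists_sub_matrixCocycle_mem_range_coboundary (by omega) g
  refine ⟨c, (sub_eq_zero.1 ?_).symm⟩
  have h := add_mem hg (comap₂_mem_range_coboundary (baseHom _) hc)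
  rw [map_sub, sub_add_sub_cancel, ← H2π_eq_zero_iff, map_sub] at h
  exact h

lemma cupClass_eq_zero_of_isSymm {c : Matrix (ZMod p) (ZMod p) (ZMod p)} (hc : c.IsSymm) :
    cupClass c = 0 :=
  H2π_eq_zero_iff.2 (comap₂_mem_range_coboundary _ (matrixCocycle_mem_range_coboundary hc))

lemma matrixCocycle_shiftMatrix (x y : Multiplicative (ZMod p → ℤ_[p])) :
    (matrixCocycle (shiftMatrix p (ZMod p))).1 (x, y) =
      PadicInt.toZMod ((cupCocycle p ℤ_[p]).1 (x, y)) := by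
  simp [cupCocycle_apply, dotProduct, Matrix.mulVec, shiftMatrix_apply]

lemma cupClass_shiftMatrix : cupClass (shiftMatrix p (ZMod p)) = 0 := by
  obtain ⟨h, hh⟩ := mem_range_coboundary_iff.1 (comap₂_baseHom_self (c := cupCocycle p ℤ_[p]))
  refine H2π_eq_zero_iff.2 <| mem_range_coboundary_iff.2
    ⟨⟨fun x ↦ PadicInt.toZMod (h x), by fun_prop⟩, fun x y ↦ ?_⟩
  rw [LinearMap.comp_apply]
  simp only [comap₂_apply] at hh
  rw [comap₂_apply, matrixCocycle_shiftMatrix, hh]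
  simp

lemma exists_isSymm_of_cupClass_eq_zero {c : Matrix (ZMod p) (ZMod p) (ZMod p)}
    (hc : cupClass c = 0) : ∃ l : ZMod p, (c - l • shiftMatrix p (ZMod p)).IsSymm := by
  obtain ⟨h, hh⟩ := mem_range_coboundary_iff.1 (H2π_eq_zero_iff.1 hc)
  rw [LinearMap.comp_apply] at hh
  have h_scalar_mul (a x) : h (scalar _ a * x) = h (scalar _ a) + h x := by
    have key := hh (scalar _ a) x
    rw [comap₂_apply, baseHom_apply, scalar_base, matrixCocycle_apply, toAdd_one, map_zero,
      zero_dotProduct] at key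
    exact (sub_eq_zero.1 key.symm).symm
  let χ : ℤ_[p] →+ ZMod p := AddMonoidHom.mk' (fun a ↦ h (scalar _ (.ofAdd a))) fun a b ↦ by
    rw [ofAdd_add, map_mul, h_scalar_mul]
  have h_gen_mul_gen (i j) : h (gen i * gen j) =
      shiftMatrix p (ZMod p) i j * χ 1 + h (sec _ (.ofAdd (Pi.single i 1 + Pi.single j 1))) := by
    rw [gen, gen, sec_mul_sec, h_scalar_mul, cupCocycle_single_single, ofAdd_add]
    congr 1
    refine (addMonoidHom_padicInt_apply χ _).trans ?_
    rw [apply_ite PadicInt.toZMod, map_one, map_zero, smul_eq_mul, shiftMatrix_apply]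
  refine ⟨-χ 1, Matrix.IsSymm.ext fun i j ↦ ?_⟩
  have hij := hh (gen i) (gen j)
  have hji := hh (gen j) (gen i)
  rw [h_gen_mul_gen, comap₂_apply, baseHom_apply, baseHom_apply, gen, gen, sec_base, sec_base,
    matrixCocycle_single_single] at hij hji
  rw [add_comm (Pi.single j 1)] at hji
  simp only [Matrix.sub_apply, Matrix.smul_apply, smul_eq_mul]
  linear_combination hji - hij

lemma cupClass_eq_zero_iff {c : Matrix (ZMod p) (ZMod p) (ZMod p)} :
    cupClass c = 0 ↔ ∃ l : ZMod p, (c - l • shiftMatrix p (ZMod p)).IsSymm := by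
  refine ⟨exists_isSymm_of_cupClass_eq_zero, fun ⟨l, hl⟩ ↦ ?_⟩
  have h := cupClass_eq_zero_of_isSymm hl
  rwa [map_sub, map_smul, cupClass_shiftMatrix, smul_zero, sub_zero] at h

lemma decomposable_eq_top (hp : 3 < p) : decomposable p (CupExt p) = ⊤ := by
  refine eq_top_iff.2 fun ξ _ ↦ ?_
  obtain ⟨c, rfl⟩ := cupClass_surjective hp ξ
  rw [Matrix.matrix_eq_sum_single c]
  simp only [map_sum]
  refine Submodule.sum_mem _ fun i _ ↦ Submodule.sum_mem _ fun j _ ↦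
    Submodule.subset_span ⟨linearClass (c i j • Pi.single i 1), linearClass (Pi.single j 1),
      isCupProduct_H2π fun x y ↦ ?_⟩
  have h : Matrix.single i j (c i j) =
      Matrix.vecMulVec (c i j • Pi.single i 1) (Pi.single j 1) := by
    rw [Matrix.smul_vecMulVec, ← Matrix.single_eq_single_vecMulVec_single, Matrix.smul_single,
      smul_eq_mul, mul_one]
  rw [h]
  exact matrixCocycle_vecMulVec _ _ _ _

end CupExt

section ShiftModule

variable {n : ℕ} {R : Type*} [CommRing R] {C : Type*} [Group C]

section Equivariant

variable [NeZero n] (κ : C ≃* Multiplicative (ZMod n))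

/-- The identification of `R[C]` with the functions on `ℤ/n`, for which left multiplication becomes
the cyclic shift. The group element corresponding to `k` is the delta function at `-k`. -/
def shiftEquiv : MonoidAlgebra R C ≃ₗ[R] (ZMod n → R) :=
  haveI : Finite C := .of_equiv _ κ.symm.toEquiv
  MonoidAlgebra.coeffLinearEquiv R ≪≫ₗ Finsupp.linearEquivFunOnFinite R R C ≪≫ₗ
    LinearEquiv.funCongrLeft R R
      ((Equiv.neg _).trans (Multiplicative.ofAdd.trans κ.symm.toEquiv))

lemma shiftEquiv_apply (r : MonoidAlgebra R C) (i : ZMod n) :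
    shiftEquiv κ r i = r.coeff (κ.symm (.ofAdd (-i))) := rfl

lemma shiftEquiv_of (g : C) :
    shiftEquiv κ (MonoidAlgebra.of R C g) = Pi.single (-(κ g).toAdd) 1 := by
  classical
  ext i
  have h : g = κ.symm (.ofAdd (-i)) ↔ i = -(κ g).toAdd := by
    rw [MulEquiv.eq_symm_apply, eq_neg_iff_add_eq_zero, ← neg_eq_iff_add_eq_zero, eq_comm]
    exact Iff.rfl
  rw [shiftEquiv_apply, MonoidAlgebra.of_apply, MonoidAlgebra.coeff_single, Finsupp.single_apply,
    Pi.single_apply, if_congr h rfl rfl]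

variable {V : Type*} [AddCommGroup V] [Module R V] (ρ : Representation R C V)

lemma asAlgebraHom_apply_single {L : (ZMod n → R) →ₗ[R] V}
    (hL : ∀ g a, ρ g (L a) = L fun i ↦ a (i + (κ g).toAdd)) (r : MonoidAlgebra R C) :
    ρ.asAlgebraHom r (L (Pi.single 0 1)) = L (shiftEquiv κ r) := by
  induction r using MonoidAlgebra.induction_on with
  | of g =>
    rw [Representation.asAlgebraHom_of, hL, shiftEquiv_of]
    congr 1
    ext i
    rw [Pi.single_apply, Pi.single_apply, if_congr add_eq_zero_iff_eq_neg rfl rfl]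
  | add r s hr hs => rw [map_add, LinearMap.add_apply, hr, hs, map_add, map_add]
  | smul a r hr => rw [map_smul, LinearMap.smul_apply, hr, map_smul, map_smul]

/-- The `R[C]`-linear map corresponding to a map `L` that intertwines shifts with `ρ`. -/
def shiftHom (L : (ZMod n → R) →ₗ[R] V) : MonoidAlgebra R C →ₗ[MonoidAlgebra R C] ρ.asModule :=
  LinearMap.toSpanSingleton _ _ (ρ.asModuleEquiv.symm (L (Pi.single 0 1)))

lemma asModuleEquiv_shiftHom {L : (ZMod n → R) →ₗ[R] V}
    (hL : ∀ g a, ρ g (L a) = L fun i ↦ a (i + (κ g).toAdd)) (r : MonoidAlgebra R C) :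
    ρ.asModuleEquiv (shiftHom ρ L r) = L (shiftEquiv κ r) :=
  (ρ.asModuleEquiv_map_smul _ _).trans (asAlgebraHom_apply_single κ ρ hL r)

variable {ι : Type*} [Fintype ι] [DecidableEq ι]

/-- The `R[C]`-linear map corresponding to a map `L` that intertwines componentwise shifts
with `ρ`. -/
def shiftHomPi (L : (ι → ZMod n → R) →ₗ[R] V) :
    (ι → MonoidAlgebra R C) →ₗ[MonoidAlgebra R C] ρ.asModule :=
  LinearMap.lsum _ _ ℕ fun d ↦ shiftHom ρ (L ∘ₗ LinearMap.single R (fun _ ↦ ZMod n → R) d)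

variable {L : (ι → ZMod n → R) →ₗ[R] V}
  (hL : ∀ g a, ρ g (L a) = L fun d i ↦ a d (i + (κ g).toAdd))
include hL

lemma asModuleEquiv_shiftHomPi (r : ι → MonoidAlgebra R C) :
    ρ.asModuleEquiv (shiftHomPi ρ L r) = L fun d ↦ shiftEquiv κ (r d) := by
  have hL_single (d : ι) (g : C) (a : ZMod n → R) : ρ g ((L ∘ₗ LinearMap.single R _ d) a) =
      (L ∘ₗ LinearMap.single R _ d) fun i ↦ a (i + (κ g).toAdd) := by
    simp only [LinearMap.comp_apply, hL]
    congr 1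
    ext e i
    obtain rfl | he := eq_or_ne e d
    · simp
    · simp [he]
  rw [shiftHomPi, LinearMap.lsum_apply, LinearMap.sum_apply, map_sum,
    ← Finset.univ_sum_single fun d ↦ shiftEquiv κ (r d), map_sum]
  exact Finset.sum_congr rfl fun d _ ↦ asModuleEquiv_shiftHom κ ρ (hL_single d) (r d)

lemma shiftHomPi_surjective (hsurj : Function.Surjective L) :
    Function.Surjective (shiftHomPi ρ L) := fun ξ ↦ by
  obtain ⟨a, ha⟩ := hsurj (ρ.asModuleEquiv ξ)
  refine ⟨fun d ↦ (shiftEquiv κ).symm (a d), ρ.asModuleEquiv.injective ?_⟩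
  simp only [asModuleEquiv_shiftHomPi κ ρ hL, LinearEquiv.apply_symm_apply, ha]

end Equivariant

section PrimeOrder

variable {p : ℕ} [Fact p.Prime] [CharP R p] {κ : C ≃* Multiplicative (ZMod p)} {σ : C}
  (hσ : κ σ = .ofAdd 1)
include hσ

lemma sub_one_pow_prime_eq_zero : (MonoidAlgebra.of R C σ - 1) ^ p = 0 := by
  have h := congrArg (Polynomial.aeval (MonoidAlgebra.of R C σ))
    (sub_pow_char (p := p) (Polynomial.X : Polynomial R) 1)
  have hσp : σ ^ p = 1 := κ.injective (by
    rw [map_pow, hσ, ← ofAdd_nsmul, nsmul_one, CharP.cast_eq_zero, ofAdd_zero, map_one])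
  rw [one_pow, map_pow, map_sub, map_sub, map_pow, Polynomial.aeval_X, map_one, ← map_pow, hσp,
    map_one, sub_self] at h
  exact h

/-- In characteristic `p` the polynomial `(X - 1) ^ (p - 1)` is the `p`-th cyclotomic polynomial,
so `(σ - 1) ^ (p - 1)` is the norm element. -/
lemma shiftEquiv_sub_one_pow :
    shiftEquiv κ ((MonoidAlgebra.of R C σ - 1) ^ (p - 1)) = 1 := by
  have h := congrArg (Polynomial.aeval (MonoidAlgebra.of R C σ))
    (Polynomial.cyclotomic_mul_prime_eq_pow_of_not_dvd R (p := p) (n := 1)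
      (Nat.Prime.not_dvd_one Fact.out))
  rw [one_mul, Polynomial.cyclotomic_prime, Polynomial.cyclotomic_one] at h
  simp only [map_pow, map_sub, Polynomial.aeval_X, map_one, map_sum] at h
  rw [← h, map_sum]
  have h_pow (k : ℕ) : shiftEquiv κ (MonoidAlgebra.of R C σ ^ k) = Pi.single (-(k : ZMod p)) 1 := by
    rw [← map_pow, shiftEquiv_of, map_pow, hσ, ← ofAdd_nsmul, nsmul_one, toAdd_ofAdd]
  ext i
  rw [Finset.sum_apply, Finset.sum_eq_single (-i).val]
  · rw [h_pow, ZMod.natCast_zmod_val, neg_neg, Pi.single_eq_same, Pi.one_apply]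
  · intro k hk hki
    rw [h_pow, Pi.single_eq_of_ne]
    rintro rfl
    rw [neg_neg, ZMod.val_natCast_of_lt (Finset.mem_range.1 hk)] at hki
    exact hki rfl
  · exact fun h ↦ absurd (Finset.mem_range.2 (ZMod.val_lt _)) h

end PrimeOrder

end ShiftModule

section CyclicModule

variable {p : ℕ} [Fact p.Prime] {C : Type*} [Group C] {κ : C ≃* Multiplicative (ZMod p)} {σ : C}

/-- The canonical projection `𝔽_p[C] ^ (m + 1) → M_{p-1} × M_p ^ m`. -/
def cyclicQuotient (p : ℕ) (σ : C) (m : ℕ) : (Fin (m + 1) → MonoidAlgebra (ZMod p) C)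
    →ₗ[MonoidAlgebra (ZMod p) C] cyclicModule p σ (p - 1) × (Fin m → cyclicModule p σ p) :=
  (Submodule.mkQ _ ∘ₗ LinearMap.proj 0).prod
    (LinearMap.pi fun d ↦ Submodule.mkQ _ ∘ₗ LinearMap.proj d.succ)

lemma cyclicQuotient_surjective (σ : C) (m : ℕ) :
    Function.Surjective (cyclicQuotient p σ m) := by
  rintro ⟨x, y⟩
  obtain ⟨x, rfl⟩ := Submodule.mkQ_surjective _ x
  choose z hz using fun d ↦ Submodule.mkQ_surjective _ (y d)
  exact ⟨Fin.cons x z, Prod.ext rfl (funext hz)⟩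

lemma ker_cyclicQuotient (hσ : κ σ = .ofAdd 1) (m : ℕ) : (cyclicQuotient p σ m).ker =
    Submodule.span _ {Pi.single 0 ((MonoidAlgebra.of (ZMod p) C σ - 1) ^ (p - 1))} := by
  ext r
  have mem_ker_iff : r ∈ (cyclicQuotient p σ m).ker ↔
      r 0 ∈ Ideal.span {(MonoidAlgebra.of (ZMod p) C σ - 1) ^ (p - 1)} ∧
        ∀ d : Fin m, r d.succ = 0 := by
    rw [LinearMap.mem_ker, Prod.ext_iff, funext_iff]
    refine and_congr (Submodule.Quotient.mk_eq_zero _) (forall_congr' fun d ↦ ?_)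
    refine (Submodule.Quotient.mk_eq_zero _).trans ?_
    rw [sub_one_pow_prime_eq_zero hσ, Ideal.span_singleton_zero, Submodule.mem_bot]
    rfl
  rw [mem_ker_iff, Ideal.mem_span_singleton', Submodule.mem_span_singleton]
  constructor
  · rintro ⟨⟨a, ha⟩, hr⟩
    refine ⟨a, funext (Fin.cases ?_ fun d ↦ ?_)⟩
    · simpa using ha
    · simp [hr]
  · rintro ⟨a, rfl⟩
    exact ⟨⟨a, by simp⟩, by simp⟩

variable {V : Type*} [AddCommGroup V] [Module (ZMod p) V] (ρ : Representation (ZMod p) C V)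

lemma nonempty_linearEquiv_cyclicModule (hσ : κ σ = .ofAdd 1)
    {L : (ZMod p → ZMod p) →ₗ[ZMod p] V}
    (hL : ∀ g a, ρ g (L a) = L fun i ↦ a (i + (κ g).toAdd)) (hbij : Function.Bijective L) :
    Nonempty (ρ.asModule ≃ₗ[MonoidAlgebra (ZMod p) C] cyclicModule p σ p) := by
  have shiftHom_bijective : Function.Bijective (shiftHom ρ L) := by
    rw [← ρ.asModuleEquiv.bijective.of_comp_iff']
    convert hbij.comp (shiftEquiv κ).bijective using 1
    exact funext (asModuleEquiv_shiftHom κ ρ hL)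
  refine ⟨(LinearEquiv.ofBijective _ shiftHom_bijective).symm ≪≫ₗ
    (Submodule.quotEquivOfEqBot _ ?_).symm⟩
  rw [sub_one_pow_prime_eq_zero hσ, Ideal.span_singleton_eq_bot]

variable {m : ℕ} {L : (Fin (m + 1) → ZMod p → ZMod p) →ₗ[ZMod p] V}
  (hL : ∀ g a, ρ g (L a) = L fun d i ↦ a d (i + (κ g).toAdd))
  (hker : ∀ a, L a = 0 ↔ ∃ l : ZMod p, a = Pi.single 0 fun _ ↦ l)
include hL hker

lemma ker_shiftHomPi (hσ : κ σ = .ofAdd 1) : (shiftHomPi ρ L).ker =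
    Submodule.span _ {Pi.single 0 ((MonoidAlgebra.of (ZMod p) C σ - 1) ^ (p - 1))} := by
  have mem_ker_iff (r) : r ∈ (shiftHomPi ρ L).ker ↔ ∃ l : ZMod p,
      r = l • Pi.single 0 ((MonoidAlgebra.of (ZMod p) C σ - 1) ^ (p - 1)) := by
    rw [LinearMap.mem_ker, ← ρ.asModuleEquiv.map_eq_zero_iff, asModuleEquiv_shiftHomPi κ ρ hL, hker]
    refine exists_congr fun l ↦ ?_
    let e := LinearEquiv.piCongrRight fun _ : Fin (m + 1) ↦ shiftEquiv (R := ZMod p) κ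
    have he : e (l • Pi.single 0 ((MonoidAlgebra.of (ZMod p) C σ - 1) ^ (p - 1))) =
        Pi.single 0 fun _ ↦ l := by
      rw [map_smul]
      ext d i
      change l • shiftEquiv κ ((Pi.single 0 _ : Fin (m + 1) → MonoidAlgebra (ZMod p) C) d) i = _
      obtain rfl | hd := eq_or_ne d 0
      · rw [Pi.single_eq_same, shiftEquiv_sub_one_pow hσ, Pi.single_eq_same]
        exact mul_one l
      · rw [Pi.single_eq_of_ne hd, map_zero, Pi.single_eq_of_ne hd]
        exact mul_zero l
    rw [← he]
    exact e.injective.eq_iff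
  refine le_antisymm (fun r hr ↦ ?_) ((Submodule.span_singleton_le_iff_mem _ _).2 ?_)
  · obtain ⟨l, rfl⟩ := (mem_ker_iff r).1 hr
    exact Submodule.smul_of_tower_mem _ l (Submodule.mem_span_singleton_self _)
  · exact (mem_ker_iff _).2 ⟨1, (one_smul _ _).symm⟩

lemma nonempty_linearEquiv_cyclicModule_prod (hσ : κ σ = .ofAdd 1)
    (hsurj : Function.Surjective L) :
    Nonempty (ρ.asModule ≃ₗ[MonoidAlgebra (ZMod p) C]
      cyclicModule p σ (p - 1) × (Fin m → cyclicModule p σ p)) :=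
  ⟨((shiftHomPi ρ L).quotKerEquivOfSurjective (shiftHomPi_surjective κ ρ hL hsurj)).symm ≪≫ₗ
    Submodule.quotEquivOfEq _ _
      ((ker_shiftHomPi ρ hL hker hσ).trans (ker_cyclicQuotient hσ m).symm) ≪≫ₗ
    (cyclicQuotient p σ m).quotKerEquivOfSurjective (cyclicQuotient_surjective σ m)⟩

end CyclicModule

section HalfMatrix

variable {n m : ℕ}

/-- The residues `1, …, m` modulo `n`. For `n = 2 * m + 1` they form half of the nonzero residues,
one from each pair `±x`. -/
def offset (n : ℕ) (d : Fin m) : ZMod n := ((d + 1 : ℕ) : ZMod n)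

lemma val_offset (hn : n = 2 * m + 1) (d : Fin m) : (offset n d).val = d + 1 :=
  ZMod.val_natCast_of_lt (by omega)

lemma offset_injective (hn : n = 2 * m + 1) : Function.Injective (offset n : Fin m → ZMod n) :=
  fun d e h ↦ Fin.ext (by simpa only [val_offset hn, add_left_inj] using congrArg ZMod.val h)

lemma offset_add_offset_ne_zero (hn : n = 2 * m + 1) (d e : Fin m) :
    offset n d + offset n e ≠ 0 := by
  rw [offset, offset, ← Nat.cast_add, Ne, ZMod.natCast_eq_zero_iff]
  exact Nat.not_dvd_of_pos_of_lt (by omega) (by omega)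

lemma exists_offset_eq (hn : n = 2 * m + 1) {x : ZMod n} (hx : x ≠ 0) :
    ∃ d : Fin m, offset n d = x ∨ offset n d = -x := by
  have : NeZero n := ⟨by omega⟩
  have h_pos : 0 < x.val := ZMod.val_pos.2 hx
  have h_lt := x.val_lt
  obtain h | h := le_or_gt x.val m
  · refine ⟨⟨x.val - 1, by omega⟩, .inl ?_⟩
    rw [offset, Nat.sub_add_cancel h_pos, ZMod.natCast_zmod_val]
  · refine ⟨⟨n - x.val - 1, by omega⟩, .inr ?_⟩
    rw [offset, Nat.sub_add_cancel (by omega), Nat.cast_sub h_lt.le, ZMod.natCast_self,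
      ZMod.natCast_zmod_val, zero_sub]

variable {R : Type*} [Ring R]

/-- The matrix with `a d` along the diagonal `j - i = offset n d` and zeros elsewhere. For
`n = 2 * m + 1` such matrices are a complement of the symmetric ones. -/
def halfMatrix : (Fin m → ZMod n → R) →ₗ[R] Matrix (ZMod n) (ZMod n) R where
  toFun a := .of fun i j ↦ ∑ d, if j = i + offset n d then a d i else 0
  map_add' a b := by
    ext i j
    simp only [Matrix.of_apply, Matrix.add_apply, Pi.add_apply, ← Finset.sum_add_distrib,
      ite_add_ite, add_zero]
  map_smul' l a := by
    ext i j
    simp only [Matrix.of_apply, Matrix.smul_apply, Pi.smul_apply, Finset.smul_sum, smul_ite,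
      smul_zero, RingHom.id_apply]

lemma halfMatrix_apply (a : Fin m → ZMod n → R) (i j : ZMod n) :
    halfMatrix a i j = ∑ d, if j = i + offset n d then a d i else 0 := rfl

lemma halfMatrix_submatrix_add (a : Fin m → ZMod n → R) (k : ZMod n) :
    (halfMatrix a).submatrix (· + k) (· + k) = halfMatrix fun d i ↦ a d (i + k) := by
  ext i j
  simp only [Matrix.submatrix_apply, halfMatrix_apply, add_right_comm i k, add_left_inj]

lemma halfMatrix_single_zero :
    halfMatrix (Pi.single 0 1 : Fin (m + 1) → ZMod n → R) = shiftMatrix n R := by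
  ext i j
  rw [halfMatrix_apply, Finset.sum_eq_single_of_mem 0 (Finset.mem_univ 0) fun d _ hd ↦ by
    rw [Pi.single_eq_of_ne hd, Pi.zero_apply, ite_self]]
  simp [offset, shiftMatrix_apply]

section

variable (hn : n = 2 * m + 1) (a : Fin m → ZMod n → R) (d : Fin m) (i : ZMod n)
include hn

lemma halfMatrix_apply_add_offset : halfMatrix a i (i + offset n d) = a d i := by
  rw [halfMatrix_apply, Finset.sum_eq_single_of_mem d (Finset.mem_univ d) fun e _ hed ↦
    if_neg fun h ↦ hed (offset_injective hn (add_left_cancel h)).symm, if_pos rfl]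

lemma halfMatrix_add_offset_apply : halfMatrix a (i + offset n d) i = 0 := by
  rw [halfMatrix_apply]
  refine Finset.sum_eq_zero fun e _ ↦ if_neg fun h ↦ offset_add_offset_ne_zero hn d e ?_
  rwa [add_assoc, left_eq_add] at h

end

lemma halfMatrix_isSymm_iff (hn : n = 2 * m + 1) {a : Fin m → ZMod n → R} :
    (halfMatrix a).IsSymm ↔ a = 0 := by
  refine ⟨fun h ↦ funext₂ fun d i ↦ ?_, ?_⟩
  · rw [← halfMatrix_apply_add_offset hn a, ← h.apply, halfMatrix_add_offset_apply hn]
    rfl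
  · rintro rfl
    rw [map_zero]
    exact Matrix.isSymm_zero

lemma exists_isSymm_sub_halfMatrix (hn : n = 2 * m + 1) (c : Matrix (ZMod n) (ZMod n) R) :
    ∃ a : Fin m → ZMod n → R, (c - halfMatrix a).IsSymm := by
  let a : Fin m → ZMod n → R := fun d i ↦ c i (i + offset n d) - c (i + offset n d) i
  have h_offset (d : Fin m) (i : ZMod n) :
      (c - halfMatrix a) (i + offset n d) i = (c - halfMatrix a) i (i + offset n d) := by
    rw [Matrix.sub_apply, Matrix.sub_apply, halfMatrix_apply_add_offset hn,
      halfMatrix_add_offset_apply hn, sub_zero, sub_sub_cancel]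
  refine ⟨a, Matrix.IsSymm.ext fun i j ↦ ?_⟩
  obtain rfl | hij := eq_or_ne i j
  · rfl
  obtain ⟨d, hd | hd⟩ := exists_offset_eq hn (sub_ne_zero.2 hij.symm)
  · rw [← add_sub_cancel i j, ← hd]
    exact h_offset d i
  · rw [← add_sub_cancel j i, ← neg_sub j i, ← hd]
    exact (h_offset d j).symm

end HalfMatrix

namespace CupExt

variable {p : ℕ} [Fact p.Prime]

section HalfClass

variable {m : ℕ}

lemma cupClass_halfMatrix_surjective (hp : 3 < p) (hm : p = 2 * m + 1) :
    Function.Surjective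
      (cupClass ∘ₗ (halfMatrix : (Fin m → ZMod p → ZMod p) →ₗ[ZMod p] _)) := fun ξ ↦ by
  obtain ⟨c, rfl⟩ := cupClass_surjective hp ξ
  obtain ⟨a, ha⟩ := exists_isSymm_sub_halfMatrix hm c
  refine ⟨a, (sub_eq_zero.1 ?_).symm⟩
  rw [LinearMap.comp_apply, ← map_sub, cupClass_eq_zero_of_isSymm ha]

lemma cupClass_halfMatrix_eq_zero_iff (hm : p = 2 * (m + 1) + 1)
    (a : Fin (m + 1) → ZMod p → ZMod p) :
    cupClass (halfMatrix a) = 0 ↔ ∃ l : ZMod p, a = Pi.single 0 fun _ ↦ l := by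
  rw [cupClass_eq_zero_iff]
  refine exists_congr fun l ↦ ?_
  have h : l • (Pi.single 0 1 : Fin (m + 1) → ZMod p → ZMod p) = Pi.single 0 fun _ ↦ l := by
    rw [← Pi.single_smul]
    exact congrArg _ (funext fun _ ↦ mul_one l)
  rw [← halfMatrix_single_zero (m := m), ← map_smul, ← map_sub, halfMatrix_isSymm_iff hm,
    sub_eq_zero, h]

end HalfClass

section Action

variable {C : Type*} [Group C] [MulDistribMulAction C (CupExt p)]
  {κ : C →* Multiplicative (ZMod p)}
  (hκ : ∀ (g : C) (x : CupExt p), (g • x).base = shift κ ℤ_[p] g x.base)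
include hκ

lemma modP_base_inv_smul (g : C) (x : CupExt p) :
    modP (g⁻¹ • x).base.toAdd = modP x.base.toAdd ∘ (Equiv.addRight (κ g).toAdd).symm := by
  ext i
  rw [hκ, modP_apply, shift_apply, map_inv, toAdd_inv]
  rfl

variable [ContinuousConstSMul C (CupExt p)]

lemma cohomologyRep_linearClass (g : C) (a : ZMod p → ZMod p) :
    cohomologyRep p C (CupExt p) 1 g (linearClass a) =
      linearClass fun i ↦ a (i + (κ g).toAdd) := by
  refine (cohomologyRep_H1π g _).trans <| congrArg (H1π p (CupExt p)) <| Subtype.ext <|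
    ContinuousMap.ext fun x ↦ ?_
  change a ⬝ᵥ modP (g⁻¹ • x).base.toAdd = _
  rw [modP_base_inv_smul hκ, dotProduct_comp_equiv_symm]
  rfl

lemma cohomologyRep_cupClass (g : C) (c : Matrix (ZMod p) (ZMod p) (ZMod p)) :
    cohomologyRep p C (CupExt p) 2 g (cupClass c) =
      cupClass (c.submatrix (· + (κ g).toAdd) (· + (κ g).toAdd)) := by
  refine (cohomologyRep_H2π g _).trans <| congrArg (H2π p (CupExt p)) <| Subtype.ext <|
    ContinuousMap.ext fun ⟨x, y⟩ ↦ ?_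
  change modP (g⁻¹ • x).base.toAdd ⬝ᵥ c.mulVec (modP (g⁻¹ • y).base.toAdd) = _
  rw [modP_base_inv_smul hκ, modP_base_inv_smul hκ, comp_equiv_symm_dotProduct,
    ← Matrix.submatrix_mulVec_equiv]
  rfl

end Action

section Structure

variable {C : Type*} [Group C] [MulDistribMulAction C (CupExt p)]
  [ContinuousConstSMul C (CupExt p)] {κ : C ≃* Multiplicative (ZMod p)} {σ : C}
  (hκ : ∀ (g : C) (x : CupExt p), (g • x).base = shift (κ : C →* _) ℤ_[p] g x.base)
  (hσ : κ σ = .ofAdd 1)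
include hκ hσ

theorem nonempty_H1_linearEquiv (hp : 2 < p) :
    Nonempty ((cohomologyRep p C (CupExt p) 1).asModule
      ≃ₗ[MonoidAlgebra (ZMod p) C] cyclicModule p σ p) :=
  nonempty_linearEquiv_cyclicModule _ hσ (fun g a ↦ cohomologyRep_linearClass hκ g a)
    (linearClass_bijective hp)

theorem nonempty_H2_linearEquiv (hp : 3 < p) {m : ℕ} (hm : p = 2 * (m + 1) + 1) :
    Nonempty ((cohomologyRep p C (CupExt p) 2).asModule
      ≃ₗ[MonoidAlgebra (ZMod p) C]
        cyclicModule p σ (p - 1) × (Fin m → cyclicModule p σ p)) := by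
  refine nonempty_linearEquiv_cyclicModule_prod _ (fun g a ↦ ?_)
    (cupClass_halfMatrix_eq_zero_iff hm) hσ (cupClass_halfMatrix_surjective hp hm)
  rw [LinearMap.comp_apply, cohomologyRep_cupClass hκ, halfMatrix_submatrix_add]
  rfl

end Structure

end CupExt

end

end ProPOperator

theorem mainTheorem7 (p : ℕ) [Fact p.Prime] (hp : 3 < p)
    (C : Type*) [Group C] (hC : Nat.card C = p) (σ : C) (hσ : Subgroup.zpowers σ = ⊤) :
    ∃ (Ω : ProfiniteGrp.{0}) (_ : MulDistribMulAction C Ω) (_ : ContinuousConstSMul C Ω),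
      ProPOperator.IsProP p Ω ∧
      (∀ x : Ω, IsOfFinOrder x → x = 1) ∧
      Nonempty ((ProPOperator.cohomologyRep p C Ω 1).asModule
        ≃ₗ[MonoidAlgebra (ZMod p) C] ProPOperator.cyclicModule p σ p) ∧
      ProPOperator.decomposable p Ω = ⊤ ∧
      Nonempty ((ProPOperator.cohomologyRep p C Ω 2).asModule
        ≃ₗ[MonoidAlgebra (ZMod p) C]
          ProPOperator.cyclicModule p σ (p - 1) ×
            (Fin ((p - 3) / 2) → ProPOperator.cyclicModule p σ p)) ∧
      ProPOperator.IsCyclicCupExtension p σ Ω := by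
  have hgen : ∀ x, x ∈ Subgroup.zpowers σ := fun x ↦ hσ ▸ Subgroup.mem_top x
  let κ := (zmodMulEquivOfGenerator hgen hC).symm
  have hκσ : κ σ = .ofAdd 1 := zmodMulEquivOfGenerator_symm_apply_generator hgen hC
  let action := ProPOperator.cupAction (κ : C →* Multiplicative (ZMod p))
  have continuous_action :=
    ProPOperator.cupAction_continuousConstSMul (κ : C →* Multiplicative (ZMod p))
  have hκ (g : C) (x : ProPOperator.CupExt p) :
      (g • x).base = ProPOperator.shift (κ : C →* _) ℤ_[p] g x.base := rfl
  have hm : p = 2 * ((p - 3) / 2 + 1) + 1 := by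
    obtain ⟨k, hk⟩ := (Fact.out : p.Prime).odd_of_ne_two (by omega)
    omega
  exact ⟨.of (ProPOperator.CupExt p), action, continuous_action,
    ProPOperator.cupExt_isProP p,
    fun _ ↦ ProPOperator.CocycleExt.eq_one_of_isOfFinOrder,
    ProPOperator.CupExt.nonempty_H1_linearEquiv hκ hκσ (by omega),
    ProPOperator.CupExt.decomposable_eq_top hp,
    ProPOperator.CupExt.nonempty_H2_linearEquiv hκ hκσ hp hm,
    ProPOperator.isCyclicCupExtension hκσ⟩
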